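/- Let $\mathbb L/\mathbb K$ be a finite cyclic Galois extension of degree $n$, let $\theta$ be a generator of $\mathrm{Gal}(\mathbb L/\mathbb K)$, and let $\mathbb L[X;\theta]$ be the skew polynomial ring, with $Xa=\theta(a)X$ for $a\in\mathbb L$. Let $\boldsymbol\alpha=(\alpha_1,\dots,\alpha_\ell)\in(\mathbb L^*)^\ell$ have entries with pairwise distinct norms $\lambda_i=\mathrm N_{\mathbb L/\mathbb K}(\alpha_i)$, put $\Lambda=\{\lambda_1,\dots,\lambda_\ell\}$, $H_\Lambda(X)=\prod_{i=1}^{\ell}(X^n-\lambda_i)$ and $R=\mathbb L[X;\theta]/(H_\Lambda)$. The sum-rank weight of $F\in R$ is $\mathrm{wt}_\Lambda(F)=\ell n-\deg\gcd_{\rm right}(F,H_\Lambda)$, where $\gcd_{\rm right}$ is the greatest common right divisor, and the sum-rank distance is $\mathrm d_\Lambda(F,G)=\mathrm{wt}_\Lambda(F-G)$. Let $\mathbb L[\theta]$ be the skew group algebra of formal sums $\sum_{i=0}^{n-1}f_i\theta^i$ with $f_i\in\mathbb L$ and $(a\theta^i)(b\theta^j)=a\,\theta^i(b)\,\theta^{i+j}$,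 with adjoint $(\sum_i f_i\theta^i)^\top=\sum_i\theta^{-i}(f_i)\theta^{-i}$. For $v\in(\mathbb Z/2)^\ell$ let $\Upsilon_v$ be the map on $(\mathbb L[\theta])^\ell$ that replaces the $i$-th component by its adjoint exactly when $v_i=1$. For a vector $\boldsymbol\beta\in\mathbb L^\ell$ whose entries have norms in $\Lambda$, let $\overline\Phi_{\boldsymbol\beta}:R\to(\mathbb L[\theta])^\ell$ be the ring homomorphism induced by $F(X)\mapsto(\Phi(F(\beta_1X)),\dots,\Phi(F(\beta_\ell X)))$, where $\Phi(\sum_i f_iX^i)=\sum_i f_i\theta^i$. For $\pi\in\mathcal S_\ell$ put $\pi(\boldsymbol\alpha)=(\alpha_{\pi^{-1}(1)},\dots,\alpha_{\pi^{-1}(\ell)})$. Let $$\mathcal G=\bigl((\mathrm{GL}(n,\mathbb K)^\ell\times\mathrm{GL}(n,\mathbb K)^\ell)\rtimes(\mathbb Z/2)^\ell\bigr)\rtimes\mathcal S_\ell ,$$ where in each semidirect product the left factor is normal, $v\in(\mathbb Z/2)^\ell$ exchanges $M_i$ and $N_i$ in a pair $((M_i)_i,(N_i)_i)$ whenever $v_i=1$,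 and $\mathcal S_\ell$ permutes the $\ell$ indices. Write the elements of $\mathcal G$ as $(\pi,(M_i)_i,(N_i)_i,v)$. Let $\mathcal N\le\mathcal G$ be the normal subgroup of all elements with $\pi=\mathrm{id}$, $M_i=c_iI_n$ and $N_i=c_i^{-1}I_n$ for some $c_1,\dots,c_\ell\in\mathbb K^*$, and with $v=0$ if $n\ge2$ (if $n=1$, $v$ is arbitrary). Then $\overline\Phi_{\boldsymbol\alpha}$ is bijective, and there is a group isomorphism $e$ from $\mathcal G/\mathcal N$ onto the group of $\mathbb K$-linear bijections $R\to R$ that preserve $\mathrm d_\Lambda$, such that: 1. for every $g=(\pi,(M_i)_i,(N_i)_i,v)\in\mathcal G$ there are $A,B\in R$ with $\mathrm{wt}_\Lambda(A)=\mathrm{wt}_\Lambda(B)=\ell n$ and $$e(g\mathcal N)(F)=A\cdot(\overline\Phi_{\boldsymbol\alpha}^{-1}\circ\Upsilon_v\circ\overline\Phi_{\pi(\boldsymbol\alpha)})(F)\cdot B\qquad\text{for all }F\in R;$$ 2. conversely, for all $\pi\in\mathcal S_\ell$, $v\in(\mathbb Z/2)^\ell$ and $A,B\in R$ with $\mathrm{wt}_\Lambda(A)=\mathrm{wt}_\Lambda(B)=\ell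 n$ there are $(M_i)_i,(N_i)_i\in\mathrm{GL}(n,\mathbb K)^\ell$ for which the same formula holds with $g=(\pi,(M_i)_i,(N_i)_i,v)$. -/

import Mathlib

noncomputable section

namespace SumRank

/-! ### The skew polynomial ring `L[X;θ]` -/

section Skew

variable {K L : Type*} [Field K] [Field L] [Algebra K L]

/-- The action of `ℕ` (written multiplicatively) on `L` in which `i` acts as `θ ^ i`. -/
abbrev thetaAction (θ : L ≃ₐ[K] L) : MulSemiringAction (Multiplicative ℕ) L :=
  MulSemiringAction.compHom L (powersHom (L ≃ₐ[K] L) θ)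

/-- The skew polynomial ring `L[X;θ]`, with multiplication rule `X a = θ(a) X`. -/
def SkewPoly (_θ : L ≃ₐ[K] L) : Type _ := SkewPolynomial L

instance instRing (θ : L ≃ₐ[K] L) : Ring (SkewPoly θ) :=
  @SkewMonoidAlgebra.instRing L (Multiplicative ℕ) _ _ (thetaAction θ)

namespace SkewPoly

variable (θ : L ≃ₐ[K] L)

/-- The constant skew polynomials. -/
def C : L →+* SkewPoly θ :=
  letI := thetaAction θ
  (SkewPolynomial.CRingHom : L →+* SkewPolynomial L)

/-- The indeterminate. -/
def X : SkewPoly θ := (SkewPolynomial.X : SkewPolynomial L)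

variable {θ}

/-- The degree of a skew polynomial (`0` for the zero polynomial). -/
def degree (F : SkewPoly θ) : ℕ := (SkewPolynomial.support (R := L) F).sup id

theorem X_mul_C_aux [MulSemiringAction (Multiplicative ℕ) L] (a : L) :
    (SkewPolynomial.X : SkewPolynomial L) * SkewPolynomial.C a =
      SkewPolynomial.C (Multiplicative.ofAdd 1 • a) * SkewPolynomial.X := by
  rw [SkewPolynomial.C_mul_X_eq_monomial, ← SkewPolynomial.monomial_zero_left,
    SkewPolynomial.X_mul_monomial]
  rfl

theorem X_mul_C (a : L) : X θ * C θ a = C θ (θ a) * X θ :=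
  @X_mul_C_aux L _ (thetaAction θ) a

theorem induction_on {P : SkewPoly θ → Prop} (F : SkewPoly θ)
    (hadd : ∀ F G, P F → P G → P (F + G)) (hmon : ∀ (a : L) (i : ℕ), P (C θ a * X θ ^ i)) :
    P F := by
  have e : ∀ (i : ℕ) (a : L), (C θ a * X θ ^ i : SkewPoly θ) =
      (SkewPolynomial.monomial i a : SkewPolynomial L) := fun i a =>
    @SkewPolynomial.C_mul_X_pow_eq_monomial L _ a (thetaAction θ) i
  have hm : ∀ (i : ℕ) (a : L), P (SkewPolynomial.monomial i a : SkewPolynomial L) :=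
    fun i a => e i a ▸ hmon a i
  refine SkewPolynomial.induction (R := L) (motive := P) F ?_ ?_
  · have h := hm 0 0
    rwa [SkewPolynomial.monomial_zero_right] at h
  · intro n r q _ _ hq
    exact hadd _ _ (hm n r) hq

/-- `K` is fixed by `θ`, so `L[X;θ]` is a `K`-algebra. -/
instance instAlgebra (θ : L ≃ₐ[K] L) : Algebra K (SkewPoly θ) :=
  RingHom.toAlgebra' ((C θ).comp (algebraMap K L)) (by
    intro k F
    simp only [RingHom.comp_apply]
    induction F using induction_on with
    | hadd F G hF hG => rw [mul_add, add_mul, hF, hG]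
    | hmon a i =>
      have h : ∀ i : ℕ, X θ ^ i * C θ (algebraMap K L k) =
          C θ (algebraMap K L k) * X θ ^ i := by
        intro i
        have h1 : Commute (X θ) (C θ (algebraMap K L k)) := by
          change X θ * _ = _
          rw [X_mul_C, AlgEquiv.commutes]
        exact (h1.pow_left i)
      rw [mul_assoc, h, ← mul_assoc, ← mul_assoc, ← map_mul, ← map_mul, mul_comm a])

theorem algebraMap_eq (k : K) : algebraMap K (SkewPoly θ) k = C θ (algebraMap K L k) := rfl

/-- `D` is a right divisor of `F`. -/
def RightDvd (D F : SkewPoly θ) : Prop := ∃ Q, F = Q * D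

/-- The degree of the greatest common right divisor of `F` and `G`, i.e. the largest degree of
a common right divisor. -/
def degGcrd (F G : SkewPoly θ) : ℕ :=
  sSup {d | ∃ D, RightDvd D F ∧ RightDvd D G ∧ degree D = d}

/-- The ring endomorphism `F(X) ↦ F_α(X) = F(αX)`. -/
def scale (θ : L ≃ₐ[K] L) (α : L) : SkewPoly θ →+* SkewPoly θ :=
  letI := thetaAction θ
  SkewMonoidAlgebra.liftNCRingHom (k := L) (G := Multiplicative ℕ) (C θ)
    (powersHom (SkewPoly θ) (C θ α * X θ)) (by
      intro x y
      change C θ ((θ ^ y.toAdd) x) * (C θ α * X θ) ^ y.toAdd =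
        (C θ α * X θ) ^ y.toAdd * C θ x
      generalize y.toAdd = i
      induction i generalizing x with
      | zero => simp
      | succ i ih =>
        have h1 : (C θ α * X θ) * C θ x = C θ (θ x) * (C θ α * X θ) := by
          rw [mul_assoc, X_mul_C, ← mul_assoc, ← mul_assoc, ← map_mul, ← map_mul, mul_comm α]
        calc C θ ((θ ^ (i + 1)) x) * (C θ α * X θ) ^ (i + 1)
            = (C θ ((θ ^ i) (θ x)) * (C θ α * X θ) ^ i) * (C θ α * X θ) := by
              rw [pow_succ, pow_succ, mul_assoc, AlgEquiv.mul_apply]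
          _ = (C θ α * X θ) ^ (i + 1) * C θ x := by
              rw [ih, pow_succ, mul_assoc, mul_assoc, h1])

theorem scale_C (α a : L) : scale θ α (C θ a) = C θ a := by
  let _ := thetaAction θ
  have := SkewMonoidAlgebra.liftNC_single (C θ : L →+ SkewPoly θ)
    (powersHom (SkewPoly θ) (C θ α * X θ)) 1 a
  refine this.trans ?_
  simp

theorem scale_X (α : L) : scale θ α (X θ) = C θ α * X θ := by
  let _ := thetaAction θ
  have := SkewMonoidAlgebra.liftNC_single (C θ : L →+ SkewPoly θ)
    (powersHom (SkewPoly θ) (C θ α * X θ)) (Multiplicative.ofAdd 1) (1 : L)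
  refine this.trans ?_
  simp

end SkewPoly

/-! ### The skew group algebra `L[θ]` -/

/-- The skew group algebra `L[Gal(L/K)]`, written `L[θ]` when `θ` generates `Gal(L/K)`. Its
elements are the formal sums `∑ a_g g`, with `(a g)(b h) = a g(b) gh`. -/
abbrev SkewGroupAlg (K L : Type*) [Field K] [Field L] [Algebra K L] : Type _ :=
  SkewMonoidAlgebra L (L ≃ₐ[K] L)

/-- The adjoint `∑ a_g g ↦ ∑ g⁻¹(a_g) g⁻¹`; for `f = ∑ f_i θ^i` this is
`∑ θ^(n-i)(f_i) θ^(n-i)`. -/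
def adjoint (f : SkewGroupAlg K L) : SkewGroupAlg K L :=
  f.sum fun g a => SkewMonoidAlgebra.single g⁻¹ (g⁻¹ a)

/-- The partial adjoint `Υ_v`: take the adjoint of the components `i` with `v i ≠ 0`, i.e. those
with `v i = 1`. -/
def partialAdjoint {ℓ : ℕ} (v : Fin ℓ → ZMod 2) (f : Fin ℓ → SkewGroupAlg K L) :
    Fin ℓ → SkewGroupAlg K L :=
  fun i => if v i = 0 then f i else adjoint (f i)

/-- The ring homomorphism `Φ : L[X;θ] → L[θ]`, `∑ f_i X^i ↦ ∑ f_i θ^i`. -/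
def Phi (θ : L ≃ₐ[K] L) : SkewPoly θ →+* SkewGroupAlg K L :=
  letI := thetaAction θ
  SkewMonoidAlgebra.mapDomainRingHom (β := L) (f := powersHom (L ≃ₐ[K] L) θ) (fun _ _ => rfl)

theorem Phi_C (θ : L ≃ₐ[K] L) (a : L) :
    Phi θ (SkewPoly.C θ a) = SkewMonoidAlgebra.single 1 a := by
  let _ := thetaAction θ
  refine (SkewMonoidAlgebra.mapDomain_single (f := powersHom (L ≃ₐ[K] L) θ) (a := 1)
    (b := a)).trans ?_
  simp

theorem Phi_X (θ : L ≃ₐ[K] L) : Phi θ (SkewPoly.X θ) = SkewMonoidAlgebra.single θ 1 := by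
  let _ := thetaAction θ
  refine (SkewMonoidAlgebra.mapDomain_single (f := powersHom (L ≃ₐ[K] L) θ)
    (a := Multiplicative.ofAdd 1) (b := (1 : L))).trans ?_
  simp

/-- The ring homomorphism `Φ_α : L[X;θ] → L[θ]^ℓ`, `F ↦ (Φ(F_{α_1}), …, Φ(F_{α_ℓ}))`. -/
def PhiVec {ℓ : ℕ} (θ : L ≃ₐ[K] L) (α : Fin ℓ → L) :
    SkewPoly θ →+* (Fin ℓ → SkewGroupAlg K L) :=
  RingHom.pi fun i => (Phi θ).comp (SkewPoly.scale θ (α i))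

/-! ### The quotient `L[X;θ]/(H_Λ)` and the sum-rank metric -/

/-- `H_Λ = ∏ (X^n - λ_i)` with `n = [L : K]`. -/
def hPoly {ℓ : ℕ} (θ : L ≃ₐ[K] L) (lam : Fin ℓ → K) : SkewPoly θ :=
  (List.ofFn fun i =>
    SkewPoly.X θ ^ Module.finrank K L - algebraMap K (SkewPoly θ) (lam i)).prod

theorem X_pow_mul_C (θ : L ≃ₐ[K] L) (i : ℕ) (a : L) :
    SkewPoly.X θ ^ i * SkewPoly.C θ a = SkewPoly.C θ ((θ ^ i) a) * SkewPoly.X θ ^ i := by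
  induction i generalizing a with
  | zero => simp
  | succ i ih =>
    rw [pow_succ, mul_assoc, SkewPoly.X_mul_C, ← mul_assoc, ih, mul_assoc, pow_succ θ,
      AlgEquiv.mul_apply]

/-- The ideal `(H_Λ)`. -/
def hIdeal {ℓ : ℕ} (θ : L ≃ₐ[K] L) (lam : Fin ℓ → K) : Ideal (SkewPoly θ) :=
  Ideal.span {hPoly θ lam}

theorem mem_hIdeal {ℓ : ℕ} {θ : L ≃ₐ[K] L} {lam : Fin ℓ → K} {F : SkewPoly θ} :
    F ∈ hIdeal θ lam ↔ ∃ Q, Q * hPoly θ lam = F :=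
  Ideal.mem_span_singleton'

theorem degGcrd_congr {ℓ : ℕ} (θ : L ≃ₐ[K] L) (lam : Fin ℓ → K) (F G : SkewPoly θ)
    (h : F - G ∈ hIdeal θ lam) :
    SkewPoly.degGcrd F (hPoly θ lam) = SkewPoly.degGcrd G (hPoly θ lam) := by
  obtain ⟨Q, hQ⟩ := mem_hIdeal.1 h
  unfold SkewPoly.degGcrd
  congr 1
  ext d
  constructor
  · rintro ⟨D, ⟨A, hA⟩, ⟨B, hB⟩, hd⟩
    refine ⟨D, ⟨A - Q * B, ?_⟩, ⟨B, hB⟩, hd⟩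
    rw [sub_mul, ← hA, mul_assoc, ← hB, hQ, sub_sub_cancel]
  · rintro ⟨D, ⟨A, hA⟩, ⟨B, hB⟩, hd⟩
    refine ⟨D, ⟨A + Q * B, ?_⟩, ⟨B, hB⟩, hd⟩
    rw [add_mul, ← hA, mul_assoc, ← hB, hQ, add_sub_cancel]

theorem single_pow (θ : L ≃ₐ[K] L) (a : L) (i : ℕ) :
    (SkewMonoidAlgebra.single θ a : SkewGroupAlg K L) ^ i =
      SkewMonoidAlgebra.single (θ ^ i) (∏ k ∈ Finset.range i, (θ ^ k) a) := by
  induction i with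
  | zero => simp
  | succ i ih =>
    rw [pow_succ, ih, SkewMonoidAlgebra.single_mul_single, Finset.prod_range_succ, pow_succ]
    rfl

variable [FiniteDimensional K L] [IsGalois K L]


theorem theta_pow_finrank (θ : L ≃ₐ[K] L) : θ ^ Module.finrank K L = 1 := by
  rw [← IsGalois.card_aut_eq_finrank K L]
  exact pow_card_eq_one'

/-- `H_Λ` is central. -/
theorem hPoly_mem_center {ℓ : ℕ} (θ : L ≃ₐ[K] L) (lam : Fin ℓ → K) :
    hPoly θ lam ∈ Subring.center (SkewPoly θ) := by
  refine Subring.list_prod_mem _ fun x hx => ?_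
  obtain ⟨i, rfl⟩ := (List.mem_ofFn' _ _).1 hx
  refine Subring.sub_mem _ ?_ ?_
  · rw [Subring.mem_center_iff]
    intro F
    induction F using SkewPoly.induction_on with
    | hadd F G hF hG => rw [mul_add, add_mul, hF, hG]
    | hmon a i =>
      rw [← mul_assoc, X_pow_mul_C, theta_pow_finrank, AlgEquiv.one_apply, mul_assoc, mul_assoc,
        ← pow_add, ← pow_add, add_comm]
  · rw [Subring.mem_center_iff]
    exact fun F => (Algebra.commutes (lam i) F).symm

/-- Since `H_Λ` is central, the left ideal it generates is two-sided. -/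
instance instIsTwoSided {ℓ : ℕ} (θ : L ≃ₐ[K] L) (lam : Fin ℓ → K) :
    (hIdeal θ lam).IsTwoSided where
  mul_mem_of_left {F} G hF := by
    obtain ⟨Q, rfl⟩ := mem_hIdeal.1 hF
    refine mem_hIdeal.2 ⟨Q * G, ?_⟩
    rw [mul_assoc, mul_assoc, Subring.mem_center_iff.1 (hPoly_mem_center θ lam) G]

/-- The `K`-algebra `L[X;θ]/(H_Λ)`. -/
abbrev SkewQuot {ℓ : ℕ} (θ : L ≃ₐ[K] L) (lam : Fin ℓ → K) : Type _ :=
  SkewPoly θ ⧸ hIdeal θ lam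

/-- The sum-rank weight `wt_Λ(F) = ℓ n - deg gcrd(F, H_Λ)` on `L[X;θ]/(H_Λ)`. -/
def weight {ℓ : ℕ} (θ : L ≃ₐ[K] L) (lam : Fin ℓ → K) (F : SkewQuot θ lam) : ℕ :=
  Quotient.liftOn' F
    (fun F => ℓ * Module.finrank K L - SkewPoly.degGcrd F (hPoly θ lam))
    (fun F G h => by
      rw [degGcrd_congr θ lam F G (Ideal.Quotient.eq.1 (Quotient.sound' h))])

/-- The sum-rank distance on `L[X;θ]/(H_Λ)`. -/
def sumRankDist {ℓ : ℕ} (θ : L ≃ₐ[K] L) (lam : Fin ℓ → K) (F G : SkewQuot θ lam) : ℕ :=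
  weight θ lam (F - G)

/-- The group (under composition) of `K`-linear isometries of `L[X;θ]/(H_Λ)`. -/
def isometryGroup {ℓ : ℕ} (θ : L ≃ₐ[K] L) (lam : Fin ℓ → K) :
    Subgroup (SkewQuot θ lam ≃ₗ[K] SkewQuot θ lam) where
  carrier := {φ | ∀ F G, sumRankDist θ lam (φ F) (φ G) = sumRankDist θ lam F G}
  one_mem' _ _ := rfl
  mul_mem' {φ ψ} hφ hψ F G := by
    rw [LinearEquiv.mul_apply, LinearEquiv.mul_apply, hφ, hψ]
  inv_mem' {φ} hφ F G := by
    have h := hφ (φ⁻¹ F) (φ⁻¹ G)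
    rw [← LinearEquiv.mul_apply, ← LinearEquiv.mul_apply, mul_inv_cancel] at h
    exact h.symm

theorem norm_eq_prod_range (θ : L ≃ₐ[K] L) (hθ : ∀ σ : L ≃ₐ[K] L, σ ∈ Subgroup.zpowers θ)
    (a : L) :
    algebraMap K L (Algebra.norm K a) =
      ∏ k ∈ Finset.range (Module.finrank K L), (θ ^ k) a := by
  classical
  have ho : orderOf θ = Module.finrank K L := by
    rw [orderOf_eq_card_of_forall_mem_zpowers hθ, IsGalois.card_aut_eq_finrank]
  rw [Algebra.norm_eq_prod_automorphisms, ← IsCyclic.image_range_orderOf hθ, ← ho,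
    Finset.prod_image]
  intro i hi j hj hij
  exact pow_injOn_Iio_orderOf (by simpa using hi) (by simpa using hj) hij

/-- `Φ_β` vanishes on `(H_Λ)` when the norms of the entries of `β` lie in `Λ`. -/
theorem PhiVec_eq_zero {ℓ : ℕ} (θ : L ≃ₐ[K] L) (hθ : ∀ σ : L ≃ₐ[K] L, σ ∈ Subgroup.zpowers θ)
    (lam : Fin ℓ → K) (β : Fin ℓ → L) (hβ : ∀ i, Algebra.norm K (β i) ∈ Set.range lam)
    (F : SkewPoly θ) (hF : F ∈ hIdeal θ lam) : PhiVec θ β F = 0 := by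
  obtain ⟨Q, rfl⟩ := mem_hIdeal.1 hF
  have h0 : PhiVec θ β (hPoly θ lam) = 0 := by
    funext i
    obtain ⟨j, hj⟩ := hβ i
    change ((Phi θ).comp (SkewPoly.scale θ (β i))) (hPoly θ lam) = 0
    rw [hPoly, map_list_prod]
    apply List.prod_eq_zero
    rw [List.mem_map]
    refine ⟨_, (List.mem_ofFn' _ _).2 ⟨j, rfl⟩, ?_⟩
    rw [map_sub, map_pow, SkewPoly.algebraMap_eq, RingHom.comp_apply, RingHom.comp_apply,
      SkewPoly.scale_X, SkewPoly.scale_C, map_mul, Phi_C, Phi_C, Phi_X,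
      SkewMonoidAlgebra.single_mul_single, one_mul, one_smul, mul_one, single_pow,
      theta_pow_finrank, ← norm_eq_prod_range θ hθ, hj, sub_self]
  rw [map_mul, h0, mul_zero]

/-- The induced ring homomorphism `L[X;θ]/(H_Λ) → L[θ]^ℓ`, for a vector `β` whose entries have
norms in `Λ`. -/
def PhiBar {ℓ : ℕ} (θ : L ≃ₐ[K] L) (hθ : ∀ σ : L ≃ₐ[K] L, σ ∈ Subgroup.zpowers θ)
    (lam : Fin ℓ → K) (β : Fin ℓ → L) (hβ : ∀ i, Algebra.norm K (β i) ∈ Set.range lam) :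
    SkewQuot θ lam →+* (Fin ℓ → SkewGroupAlg K L) :=
  Ideal.Quotient.lift (hIdeal θ lam) (PhiVec θ β) (PhiVec_eq_zero θ hθ lam β hβ)

/-- The `v`-adjoint `Φ̄_γ⁻¹ ∘ Υ_v ∘ Φ̄_β` of `F ∈ L[X;θ]/(H_Λ)` with respect to `β` and `γ`.
The inverse is the two-sided one whenever the entries of `γ` have pairwise distinct norms. -/
def vAdjoint {ℓ : ℕ} (θ : L ≃ₐ[K] L) (hθ : ∀ σ : L ≃ₐ[K] L, σ ∈ Subgroup.zpowers θ)
    (lam : Fin ℓ → K) (β γ : Fin ℓ → L) (hβ : ∀ i, Algebra.norm K (β i) ∈ Set.range lam)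
    (hγ : ∀ i, Algebra.norm K (γ i) ∈ Set.range lam) (v : Fin ℓ → ZMod 2)
    (F : SkewQuot θ lam) : SkewQuot θ lam :=
  Function.invFun (PhiBar θ hθ lam γ hγ) (partialAdjoint v (PhiBar θ hθ lam β hβ F))

end Skew

/-! ### The abstract group `((GL^ℓ × GL^ℓ) ⋊ (ℤ/2)^ℓ) ⋊ S_ℓ` -/

section Group

variable (K : Type*) [Field K] (n ℓ : ℕ)

/-- `GL(n,K)^ℓ × GL(n,K)^ℓ`. -/
abbrev GLPairs : Type _ := (Fin ℓ → GL (Fin n) K) × (Fin ℓ → GL (Fin n) K)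

/-- `v ∈ (ℤ/2)^ℓ` acts on a pair `(M, N)` by exchanging `M_i` and `N_i` whenever `v_i = 1`. -/
def swapAction : (Fin ℓ → Multiplicative (ZMod 2)) →* MulAut (GLPairs K n ℓ) where
  toFun v :=
    { toFun := fun x =>
        (fun i => if v i = 1 then x.1 i else x.2 i, fun i => if v i = 1 then x.2 i else x.1 i)
      invFun := fun x =>
        (fun i => if v i = 1 then x.1 i else x.2 i, fun i => if v i = 1 then x.2 i else x.1 i)
      left_inv := fun x => by ext1 <;> funext i <;> dsimp only <;> split_ifs <;> rfl
      right_inv := fun x => by ext1 <;> funext i <;> dsimp only <;> split_ifs <;> rfl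
      map_mul' := fun x y => by
        ext1 <;> funext i <;> simp only [Prod.fst_mul, Prod.snd_mul, Pi.mul_apply] <;>
          split_ifs <;> rfl }
  map_one' := by ext1 x; simp
  map_mul' v w := by
    have key : ∀ a b : Multiplicative (ZMod 2), a * b = 1 ↔ (a = 1 ↔ b = 1) := by decide
    ext1 x
    ext1 <;> funext i <;>
      simp only [MulEquiv.coe_mk, Equiv.coe_fn_mk, MulAut.mul_apply, Pi.mul_apply, key] <;>
      split_ifs <;> first | rfl | tauto

/-- `(GL(n,K)^ℓ × GL(n,K)^ℓ) ⋊ (ℤ/2)^ℓ`. -/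
abbrev GLPairsSwap : Type _ :=
  GLPairs K n ℓ ⋊[swapAction K n ℓ] (Fin ℓ → Multiplicative (ZMod 2))

/-- `π ∈ S_ℓ` acts by permuting the indices: the `i`-th entries of the image are the
`π⁻¹(i)`-th entries of the argument. -/
def permAction : Equiv.Perm (Fin ℓ) →* MulAut (GLPairsSwap K n ℓ) where
  toFun π :=
    { toFun := fun x => ⟨(x.left.1 ∘ π.symm, x.left.2 ∘ π.symm), x.right ∘ π.symm⟩
      invFun := fun x => ⟨(x.left.1 ∘ π, x.left.2 ∘ π), x.right ∘ π⟩
      left_inv := fun x => by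
        apply SemidirectProduct.ext <;> simp [Function.comp_assoc]
      right_inv := fun x => by
        apply SemidirectProduct.ext <;> simp [Function.comp_assoc]
      map_mul' := fun x y => by apply SemidirectProduct.ext <;> rfl }
  map_one' := rfl
  map_mul' _ _ := rfl

/-- `((GL(n,K)^ℓ × GL(n,K)^ℓ) ⋊ (ℤ/2)^ℓ) ⋊ S_ℓ`. -/
abbrev EquivGroup : Type _ := GLPairsSwap K n ℓ ⋊[permAction K n ℓ] Equiv.Perm (Fin ℓ)

variable {K n ℓ}

/-- The element of the group with components `π`, `M`, `N` and `v`. -/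
def EquivGroup.mk (π : Equiv.Perm (Fin ℓ)) (M N : Fin ℓ → GL (Fin n) K)
    (v : Fin ℓ → ZMod 2) : EquivGroup K n ℓ :=
  ⟨⟨(M, N), fun i => Multiplicative.ofAdd (v i)⟩, π⟩

variable (K n ℓ)

/-- The subgroup of the elements with `π = id`, `M_i = c_i I` and `N_i = c_i⁻¹ I` for some
`c_i ∈ Kˣ`, and with `v = 0` unless `n = 1`. (For `1 × 1` matrices transposition is trivial, so
that `v` is arbitrary in that case.) -/
def scalarSubgroup : Subgroup (EquivGroup K n ℓ) where
  carrier := {g | g.right = 1 ∧ (n ≠ 1 → g.left.right = 1) ∧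
    ∃ c : Fin ℓ → Kˣ, ∀ i,
      g.left.left.1 i = Matrix.GeneralLinearGroup.scalar (Fin n) (c i) ∧
      g.left.left.2 i = Matrix.GeneralLinearGroup.scalar (Fin n) (c i)⁻¹}
  one_mem' := ⟨rfl, fun _ => rfl, 1, fun i => by simp⟩
  mul_mem' {g h} hg hh := by
    obtain ⟨hg1, hg2, c, hc⟩ := hg
    obtain ⟨hh1, hh2, d, hd⟩ := hh
    have e : (g * h).left = g.left * h.left := by
      rw [SemidirectProduct.mul_left, hg1, map_one]; rfl
    refine ⟨by rw [SemidirectProduct.mul_right, hg1, hh1, one_mul], fun hn => ?_,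
      fun i => c i * (if g.left.right i = 1 then d i else (d i)⁻¹), fun i => ?_⟩
    · rw [e, SemidirectProduct.mul_right, hg2 hn, hh2 hn, one_mul]
    · rw [e, SemidirectProduct.mul_left]
      by_cases hv : g.left.right i = 1
      · constructor
        · simp [swapAction, hv, (hc i).1, (hd i).1]
        · simp [swapAction, hv, (hc i).2, (hd i).2, mul_comm]
      · constructor
        · simp [swapAction, hv, (hc i).1, (hd i).2]
        · simp [swapAction, hv, (hc i).2, (hd i).1]
          rw [← map_inv, ← map_mul, ← map_mul, mul_comm]
  inv_mem' {g} hg := by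
    obtain ⟨hg1, hg2, c, hc⟩ := hg
    have e : (g⁻¹).left = (g.left)⁻¹ := by
      rw [SemidirectProduct.inv_left, hg1, inv_one, map_one]; rfl
    refine ⟨by rw [SemidirectProduct.inv_right, hg1, inv_one], fun hn => ?_,
      fun i => (if g.left.right i = 1 then (c i)⁻¹ else c i), fun i => ?_⟩
    · rw [e, SemidirectProduct.inv_right, hg2 hn, inv_one]
    · rw [e, SemidirectProduct.inv_left]
      by_cases hv : g.left.right i = 1
      · constructor
        · simp [swapAction, hv, (hc i).1]
        · simp [swapAction, hv, (hc i).2]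
      · constructor
        · simp [swapAction, hv, (hc i).2]
        · simp [swapAction, hv, (hc i).1]

theorem eq_scalar_of_one (A : GL (Fin 1) K) :
    A = Matrix.GeneralLinearGroup.scalar (Fin 1) (Matrix.GeneralLinearGroup.det A) := by
  ext i j
  fin_cases i; fin_cases j
  simp

theorem scalar_conj (A : GL (Fin n) K) (c : Kˣ) :
    A * Matrix.GeneralLinearGroup.scalar (Fin n) c * A⁻¹ =
      Matrix.GeneralLinearGroup.scalar (Fin n) c := by
  have h : Matrix.GeneralLinearGroup.scalar (Fin n) c ∈ Subgroup.center (GL (Fin n) K) := by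
    rw [Matrix.GeneralLinearGroup.center_eq_range_scalar]
    exact ⟨c, rfl⟩
  rw [Subgroup.mem_center_iff.1 h A, mul_inv_cancel_right]

instance instNormal : (scalarSubgroup K n ℓ).Normal where
  conj_mem := by
    rintro x ⟨hx1, hx2, c, hc⟩ g
    have e : (g * x * g⁻¹).left = g.left * permAction K n ℓ g.right x.left * g.left⁻¹ := by
      rw [SemidirectProduct.mul_left, SemidirectProduct.mul_left, SemidirectProduct.mul_right, hx1,
        mul_one, SemidirectProduct.inv_left, ← MulAut.mul_apply, ← map_mul, mul_inv_cancel,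
        map_one, MulAut.one_apply]
    have er : (g.left * permAction K n ℓ g.right x.left * g.left⁻¹).right =
        (permAction K n ℓ g.right x.left).right := by
      rw [SemidirectProduct.mul_right, SemidirectProduct.mul_right, SemidirectProduct.inv_right,
        mul_comm, inv_mul_cancel_left]
    have el : (g.left * permAction K n ℓ g.right x.left * g.left⁻¹).left =
        g.left.left * swapAction K n ℓ g.left.right (permAction K n ℓ g.right x.left).left *
          swapAction K n ℓ (permAction K n ℓ g.right x.left).right g.left.left⁻¹ := by
      rw [SemidirectProduct.mul_left, SemidirectProduct.mul_left, SemidirectProduct.mul_right,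
        SemidirectProduct.inv_left, ← MulAut.mul_apply, ← map_mul, mul_comm, inv_mul_cancel_left]
    have hy : ∀ i, (permAction K n ℓ g.right x.left).left.1 i =
          Matrix.GeneralLinearGroup.scalar (Fin n) (c (g.right.symm i)) ∧
        (permAction K n ℓ g.right x.left).left.2 i =
          Matrix.GeneralLinearGroup.scalar (Fin n) (c (g.right.symm i))⁻¹ :=
      fun i => hc (g.right.symm i)
    have hy2 : n ≠ 1 → (permAction K n ℓ g.right x.left).right = 1 := fun hn => by
      change x.left.right ∘ g.right.symm = 1
      rw [hx2 hn]
      rfl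
    refine ⟨?_, fun hn => ?_, ?_⟩
    · rw [SemidirectProduct.mul_right, SemidirectProduct.mul_right, SemidirectProduct.inv_right,
        hx1, mul_one, mul_inv_cancel]
    · rw [e, er, hy2 hn]
    · rw [e, el]
      generalize permAction K n ℓ g.right x.left = y at hy hy2
      generalize g.left = p
      by_cases hn : n = 1
      · subst hn
        refine ⟨fun i => Matrix.GeneralLinearGroup.det ((p.left * swapAction K 1 ℓ p.right y.left *
          swapAction K 1 ℓ y.right p.left⁻¹).1 i), fun i => ⟨eq_scalar_of_one K _, ?_⟩⟩
        rw [map_inv (Matrix.GeneralLinearGroup.scalar (Fin 1)), ← eq_scalar_of_one K]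
        by_cases hv : p.right i = 1 <;> by_cases hw : y.right i = 1
        · have h1 := scalar_conj K 1 (p.left.1 i) (c (g.right.symm i))
          have h2 := scalar_conj K 1 (p.left.2 i) (c (g.right.symm i))⁻¹
          rw [map_inv] at h2
          simp [swapAction, hv, hw, (hy i).1, (hy i).2, h1, h2]
        · simp [swapAction, hv, hw, (hy i).1, (hy i).2, mul_assoc]
        · have h1 := scalar_conj K 1 (p.left.2 i) (c (g.right.symm i))
          have h2 := scalar_conj K 1 (p.left.1 i) (c (g.right.symm i))⁻¹
          rw [map_inv] at h2
          simp [swapAction, hv, hw, (hy i).1, (hy i).2, h1, h2]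
        · simp [swapAction, hv, hw, (hy i).1, (hy i).2, mul_assoc]
      · rw [hy2 hn, map_one]
        refine ⟨fun i => if p.right i = 1 then c (g.right.symm i) else (c (g.right.symm i))⁻¹,
          fun i => ?_⟩
        by_cases hv : p.right i = 1
        · constructor
          · simp [swapAction, hv, (hy i).1, scalar_conj]
          · simpa [swapAction, hv, (hy i).2] using scalar_conj K n (p.left.2 i) (c (g.right.symm i))⁻¹
        · constructor
          · simpa [swapAction, hv, (hy i).2] using scalar_conj K n (p.left.1 i) (c (g.right.symm i))⁻¹
          · simp [swapAction, hv, (hy i).1, scalar_conj]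

end Group

end SumRank

/-!
Through `Φ̄_α` and the action of `L[θ]` on `L`, the ring `L[X;θ]/(H_Λ)` becomes the ring of
`ℓ`-tuples of `n × n` matrices over `K`; in this model the sum-rank weight is the sum of the ranks
of the entries, the group acts by `X ↦ (M_i X_{π⁻¹(i)}^{(v_i)} N_iᵀ)_i` with `(v_i)` an optional
transposition, and the theorem says that these are all the linear isometries.

*The weight is a sum of ranks.* Let `F` act on `L` by `x ↦ Φ(F(α_i X))(x)` for each `i`. If `x ≠ 0`
is in the kernel of the `i`-th action, then `X - α_i θ(x)/x` splits off on the right, and since the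
norms `λ_i` are distinct, the kernels of this factor have total dimension one. Hence the kernels of
a nonzero `F` have total dimension at most `deg F` (`nullity_le_degree`). As `H_Λ` acts by zero,
its right divisors attain this bound; conversely a linear system provides a skew polynomial with
prescribed kernels whose degree attains it, and division with remainder shows that it divides
everything that vanishes there. So `deg gcrd(F, H_Λ)` is the total nullity of `F`
(`degGcrd_hPoly`). The same bound makes `Φ̄_α` injective, and counting dimensions over `L` makes
it surjective (`PhiBar_bijective`).

*The isometries of tuples of matrices.* A linear space of matrices of rank at most one has a
common column or a common row (`commonColumn_or_commonRow`), as a vector space is not the union of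
two proper subspaces. An isometry maps tuples of weight one to tuples of weight one, and by
linearity sends a block into a single block (`exists_forall_block_eq_zero`). Within a block, the
spaces `x Kⁿ` go to spaces with a common column, up to a transposition, and the spaces `Kⁿ yᵀ` then
go to spaces with a common row; after multiplication by two invertible matrices all rank one
matrices are eigenvectors, so that the map is scalar (`exists_eq_mul_mul_transpose_or`). Together
these give `exists_rep_eq`. The elements acting trivially are the scalar ones, because for
`n ≥ 2` a transposition would force matrix multiplication to be commutative (`rep_eq_one_iff`).

*The adjoint.* The adjoint of `L[θ]` is the adjoint for the trace form of `L/K`. With `T` the Gram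
matrix of this form it is `X ↦ T⁻¹ Xᵀ T` (`exists_toMat_adjoint`), so that `M Xᵀ Nᵀ` equals
`(M T) (T⁻¹ Xᵀ T) (T⁻¹ Nᵀ)`. This yields the factors `A` and `B`, which are invertible, that is, of
weight `ℓ n`.
-/

namespace SumRank

/-! ### Coefficients, degree and right division of skew polynomials -/

namespace SkewPoly

variable {K L : Type*} [Field K] [Field L] [Algebra K L] {θ : L ≃ₐ[K] L}

/-- The coefficient of `X ^ i`, coefficients being written on the left. -/
def coeff (F : SkewPoly θ) (i : ℕ) : L := SkewPolynomial.coeff (R := L) F i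

theorem C_mul_X_pow_eq_monomial (a : L) (i : ℕ) :
    (C θ a * X θ ^ i : SkewPoly θ) = (SkewPolynomial.monomial i a : SkewPolynomial L) :=
  @SkewPolynomial.C_mul_X_pow_eq_monomial L _ a (thetaAction θ) i

theorem coeff_add (F G : SkewPoly θ) (i : ℕ) : coeff (F + G) i = coeff F i + coeff G i :=
  DFunLike.congr_fun (SkewMonoidAlgebra.coeff_add (k := L) F G) _

theorem coeff_zero (i : ℕ) : coeff (0 : SkewPoly θ) i = 0 := rfl

/-- `coeff` as an additive homomorphism. -/
def coeffHom (i : ℕ) : SkewPoly θ →+ L where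
  toFun F := coeff F i
  map_zero' := rfl
  map_add' F G := coeff_add F G i

theorem coeff_sub (F G : SkewPoly θ) (i : ℕ) : coeff (F - G) i = coeff F i - coeff G i :=
  map_sub (coeffHom i) F G

theorem coeff_sum {ι : Type*} (s : Finset ι) (f : ι → SkewPoly θ) (i : ℕ) :
    coeff (∑ j ∈ s, f j) i = ∑ j ∈ s, coeff (f j) i :=
  map_sum (coeffHom i) f s

theorem coeff_C_mul_X_pow (a : L) (i j : ℕ) :
    coeff (C θ a * X θ ^ i) j = if i = j then a else 0 := by
  rw [C_mul_X_pow_eq_monomial]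
  exact SkewPolynomial.coeff_monomial

theorem ext {F G : SkewPoly θ} (h : ∀ i, coeff F i = coeff G i) : F = G := by
  apply SkewMonoidAlgebra.coeff_injective
  ext i
  exact h i.toAdd

theorem coeff_C_mul_X_pow_mul (a : L) (i : ℕ) (G : SkewPoly θ) (k : ℕ) :
    coeff (C θ a * X θ ^ i * G) k = if i ≤ k then a * (θ ^ i) (coeff G (k - i)) else 0 := by
  induction G using induction_on with
  | hadd F G hF hG =>
    rw [mul_add, coeff_add, hF, hG, coeff_add]
    split_ifs
    · rw [map_add, mul_add]
    · rw [add_zero]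
  | hmon b j =>
    have : C θ a * X θ ^ i * (C θ b * X θ ^ j) = C θ (a * (θ ^ i) b) * X θ ^ (i + j) := by
      rw [mul_assoc, ← mul_assoc (X θ ^ i), X_pow_mul_C, map_mul, pow_add, mul_assoc, mul_assoc]
    rw [this, coeff_C_mul_X_pow, coeff_C_mul_X_pow]
    by_cases h : i ≤ k
    · rw [if_pos h]
      by_cases h2 : j = k - i
      · rw [if_pos h2, if_pos (by omega)]
      · rw [if_neg h2, if_neg (by omega), map_zero, mul_zero]
    · rw [if_neg h, if_neg (by omega)]

theorem coeff_eq_zero_of_degree_lt {F : SkewPoly θ} {i : ℕ} (h : degree F < i) :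
    coeff F i = 0 := by
  by_contra hne
  have : i ∈ SkewPolynomial.support (R := L) F := SkewPolynomial.mem_support_iff.2 hne
  exact absurd (Finset.le_sup (f := id) this) (not_le.2 h)

theorem degree_le {F : SkewPoly θ} {d : ℕ} (h : ∀ i, d < i → coeff F i = 0) : degree F ≤ d := by
  refine Finset.sup_le fun i hi => ?_
  by_contra hne
  exact SkewPolynomial.mem_support_iff.1 hi (h i (not_le.1 hne))

theorem coeff_degree_ne_zero {F : SkewPoly θ} (hF : F ≠ 0) : coeff F (degree F) ≠ 0 := by
  intro h
  apply hF
  have key : ∀ k, k ≤ degree F → (∀ i, degree F - k ≤ i → coeff F i = 0) := by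
    intro k
    induction k with
    | zero =>
      intro _ i hi
      rcases (Nat.sub_zero (degree F) ▸ hi).eq_or_lt with h1 | h1
      · rw [← h1]; exact h
      · exact coeff_eq_zero_of_degree_lt h1
    | succ k ih =>
      intro hk i hi
      have := degree_le (F := F) (d := degree F - (k + 1)) fun j hj =>
        ih (by omega) j (by omega)
      omega
  exact ext fun i => key _ le_rfl i (by omega)

theorem degree_eq {F : SkewPoly θ} {d : ℕ} (h : ∀ i, d < i → coeff F i = 0)
    (hd : coeff F d ≠ 0) : degree F = d :=
  le_antisymm (degree_le h) (by
    by_contra hlt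
    exact hd (coeff_eq_zero_of_degree_lt (not_le.1 hlt)))

theorem eq_sum_range {F : SkewPoly θ} {N : ℕ} (h : ∀ i, N ≤ i → coeff F i = 0) :
    F = ∑ i ∈ Finset.range N, C θ (coeff F i) * X θ ^ i := by
  apply ext
  intro k
  rw [coeff_sum]
  simp only [coeff_C_mul_X_pow, Finset.sum_ite_eq', Finset.mem_range]
  split_ifs with hk
  · rfl
  · exact h k (not_lt.1 hk)

theorem sum_mul {ι : Type*} (s : Finset ι) (f : ι → SkewPoly θ) (G : SkewPoly θ) :
    (∑ j ∈ s, f j) * G = ∑ j ∈ s, f j * G :=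
  Finset.sum_mul _ _ _

theorem coeff_mul_add (F G : SkewPoly θ) {d e : ℕ} (hF : ∀ i, d < i → coeff F i = 0)
    (hG : ∀ i, e < i → coeff G i = 0) :
    (∀ i, d + e < i → coeff (F * G) i = 0) ∧
      coeff (F * G) (d + e) = coeff F d * (θ ^ d) (coeff G e) := by
  have key : ∀ k, coeff (F * G) k = ∑ i ∈ Finset.range (d + 1),
      if i ≤ k then coeff F i * (θ ^ i) (coeff G (k - i)) else 0 := by
    intro k
    conv_lhs => rw [eq_sum_range (F := F) (N := d + 1) fun i hi => hF i hi]
    rw [sum_mul, coeff_sum]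
    exact Finset.sum_congr rfl fun i _ => coeff_C_mul_X_pow_mul _ _ _ _
  refine ⟨fun k hk => ?_, ?_⟩
  · rw [key]
    refine Finset.sum_eq_zero fun i hi => ?_
    have := Finset.mem_range.1 hi
    rw [hG (k - i) (by omega), map_zero, mul_zero, ite_self]
  · rw [key, Finset.sum_eq_single_of_mem d (by simp)]
    · rw [if_pos (by omega), Nat.add_sub_cancel_left]
    · intro i hi hne
      have := Finset.mem_range.1 hi
      rw [hG (d + e - i) (by omega), map_zero, mul_zero, ite_self]

theorem mul_ne_zero_and_degree_mul {F G : SkewPoly θ} (hF : F ≠ 0) (hG : G ≠ 0) :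
    F * G ≠ 0 ∧ degree (F * G) = degree F + degree G := by
  obtain ⟨h1, h2⟩ := coeff_mul_add F G (fun i => coeff_eq_zero_of_degree_lt)
    (fun i => coeff_eq_zero_of_degree_lt)
  have h3 : coeff (F * G) (degree F + degree G) ≠ 0 := by
    rw [h2]
    exact mul_ne_zero (coeff_degree_ne_zero hF)
      ((map_ne_zero_iff _ (θ ^ degree F).injective).2 (coeff_degree_ne_zero hG))
  exact ⟨fun h => h3 (by rw [h, coeff_zero]), degree_eq h1 h3⟩

/-- Division with remainder by `D` on the right. -/
theorem exists_eq_mul_add {D : SkewPoly θ} (hD : D ≠ 0) (F : SkewPoly θ) :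
    ∃ Q R : SkewPoly θ, F = Q * D + R ∧ ∀ i, degree D ≤ i → coeff R i = 0 := by
  suffices key : ∀ N, ∀ F : SkewPoly θ, (∀ i, N ≤ i → coeff F i = 0) →
      ∃ Q R : SkewPoly θ, F = Q * D + R ∧ ∀ i, degree D ≤ i → coeff R i = 0 from
    key (degree F + 1) F fun i hi => coeff_eq_zero_of_degree_lt hi
  intro N
  induction N with
  | zero => exact fun F hF => ⟨0, F, by simp, fun i _ => hF i (Nat.zero_le i)⟩
  | succ N ih =>
    intro F hF
    by_cases hN : N + 1 ≤ degree D
    · exact ⟨0, F, by simp, fun i hi => hF i (hN.trans hi)⟩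
    set s := N - degree D with hs
    have hl : (θ ^ s) (coeff D (degree D)) ≠ 0 :=
      (map_ne_zero_iff _ (θ ^ s).injective).2 (coeff_degree_ne_zero hD)
    set M := C θ (coeff F N / (θ ^ s) (coeff D (degree D))) * X θ ^ s with hM
    obtain ⟨Q, R, h, hR⟩ := ih (F - M * D) (by
      intro i hi
      rw [coeff_sub, hM, coeff_C_mul_X_pow_mul, if_pos (by omega)]
      rcases hi.eq_or_lt with rfl | hi
      · rw [show N - s = degree D by omega, div_mul_cancel₀ _ hl, sub_self]
      · rw [hF i hi, coeff_eq_zero_of_degree_lt (i := i - s) (by omega), map_zero, mul_zero,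
          sub_zero])
    refine ⟨Q + M, R, ?_, hR⟩
    rw [add_mul, add_right_comm, ← h, sub_add_cancel]

theorem degree_X_pow_sub_algebraMap {n : ℕ} (hn : 0 < n) (c : L) :
    X θ ^ n - C θ c ≠ 0 ∧ degree (X θ ^ n - C θ c) = n := by
  have h : ∀ i, coeff (X θ ^ n - C θ c) i =
      (if n = i then 1 else 0) - (if 0 = i then c else 0) := by
    intro i
    have h1 := coeff_C_mul_X_pow (θ := θ) 1 n i
    have h2 := coeff_C_mul_X_pow (θ := θ) c 0 i
    rw [map_one, one_mul] at h1
    rw [pow_zero, mul_one] at h2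
    rw [coeff_sub, h1, h2]
  have h1 : coeff (X θ ^ n - C θ c) n ≠ 0 := by
    rw [h, if_pos rfl, if_neg hn.ne, sub_zero]
    exact one_ne_zero
  refine ⟨fun h0 => h1 (by rw [h0, coeff_zero]), degree_eq (fun i hi => ?_) h1⟩
  rw [h, if_neg hi.ne, if_neg (hn.trans hi).ne, sub_zero]

theorem degree_hPoly [FiniteDimensional K L] {ℓ : ℕ} (lam : Fin ℓ → K) :
    hPoly θ lam ≠ 0 ∧ degree (hPoly θ lam) = ℓ * Module.finrank K L := by
  induction ℓ with
  | zero =>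
    have h := coeff_C_mul_X_pow (θ := θ) 1 0
    simp only [map_one, pow_zero, one_mul] at h
    simp only [hPoly, List.ofFn_zero, List.prod_nil, zero_mul]
    have h1 : coeff (1 : SkewPoly θ) 0 ≠ 0 := by rw [h]; simp
    exact ⟨fun h0 => h1 (by rw [h0, coeff_zero]), degree_eq (fun i hi => by
      rw [h, if_neg hi.ne]) h1⟩
  | succ ℓ ih =>
    obtain ⟨h1, h2⟩ := ih (fun i => lam i.succ)
    obtain ⟨h3, h4⟩ := degree_X_pow_sub_algebraMap (θ := θ) (Module.finrank_pos (R := K) (M := L))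
      (algebraMap K L (lam 0))
    obtain ⟨h5, h6⟩ := mul_ne_zero_and_degree_mul h3 h1
    have e : hPoly θ lam = (X θ ^ Module.finrank K L - C θ (algebraMap K L (lam 0))) *
        hPoly θ (fun i => lam i.succ) := by
      simp only [hPoly, List.ofFn_succ, List.prod_cons]
      rfl
    rw [e]
    exact ⟨h5, by rw [h6, h4, h2]; ring⟩

end SkewPoly

/-! ### The action of the skew group algebra on `L`, and evaluation -/

variable {K L : Type*} [Field K] [Field L] [Algebra K L]

/-- The action of the skew group algebra on `L`: the element `∑ a_g g` acts as
`x ↦ ∑ a_g g(x)`. -/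
def toEnd : SkewGroupAlg K L →+* Module.End K L :=
  SkewMonoidAlgebra.liftNCRingHom (k := L) (G := L ≃ₐ[K] L)
    (Algebra.lmul K L).toRingHom (AlgEquiv.toLinearMapHom K L) (by
      intro x g
      ext y
      exact (map_mul g x y).symm)

theorem toEnd_single (g : L ≃ₐ[K] L) (a x : L) :
    toEnd (SkewMonoidAlgebra.single g a : SkewGroupAlg K L) x = a * g x :=
  LinearMap.congr_fun (SkewMonoidAlgebra.liftNC_single
    ((Algebra.lmul K L).toRingHom : L →+ Module.End K L) (AlgEquiv.toLinearMapHom K L) g a) x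

theorem toEnd_injective : Function.Injective (toEnd : SkewGroupAlg K L →+* Module.End K L) := by
  classical
  rw [injective_iff_map_eq_zero]
  intro f hf
  have hli := (linearIndependent_toLinearMap K L L).comp
    (fun g : L ≃ₐ[K] L => (g : L →ₐ[K] L)) AlgEquiv.coe_toAlgHom_injective
  have hs : ∑ g ∈ f.coeff.support, f.coeff g • ((g : L →ₐ[K] L).toLinearMap) = 0 := by
    rw [← hf]
    conv_rhs => rw [← SkewMonoidAlgebra.sum_single f]
    rw [SkewMonoidAlgebra.sum_def, Finsupp.sum, map_sum]
    refine Finset.sum_congr rfl fun g _ => ?_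
    ext x
    exact (toEnd_single g _ x).symm
  apply SkewMonoidAlgebra.coeff_injective
  ext g
  by_cases hg : g ∈ f.coeff.support
  · exact linearIndependent_iff'.1 hli _ _ hs g hg
  · simpa using hg

/-- The evaluation of `F` at the semilinear map `x ↦ α θ(x)`, i.e. the endomorphism of `L` defined
by `Φ(F(αX))`. -/
def eval (θ : L ≃ₐ[K] L) (α : L) : SkewPoly θ →+* Module.End K L :=
  toEnd.comp ((Phi θ).comp (SkewPoly.scale θ α))

variable {θ : L ≃ₐ[K] L}

theorem eval_C (α a x : L) : eval θ α (SkewPoly.C θ a) x = a * x := by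
  simp only [eval, RingHom.comp_apply]
  rw [SkewPoly.scale_C, Phi_C, toEnd_single]
  rfl

theorem eval_X (α x : L) : eval θ α (SkewPoly.X θ) x = α * θ x := by
  simp only [eval, RingHom.comp_apply]
  rw [SkewPoly.scale_X, map_mul, Phi_C, Phi_X, map_mul, Module.End.mul_apply, toEnd_single,
    toEnd_single, one_mul]
  rfl

theorem eval_C_mul (α a x : L) (F : SkewPoly θ) :
    eval θ α (SkewPoly.C θ a * F) x = a * eval θ α F x := by
  rw [map_mul, Module.End.mul_apply, eval_C]

theorem finrank_ker_mul_le [FiniteDimensional K L] (f g : Module.End K L) :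
    Module.finrank K (LinearMap.ker (f * g)) ≤
      Module.finrank K (LinearMap.ker f) + Module.finrank K (LinearMap.ker g) := by
  let h : LinearMap.ker (f * g) →ₗ[K] LinearMap.ker f :=
    (g.comp (LinearMap.ker (f * g)).subtype).codRestrict _ fun x => x.2
  let k : LinearMap.ker h →ₗ[K] LinearMap.ker g :=
    ((LinearMap.ker (f * g)).subtype.comp (LinearMap.ker h).subtype).codRestrict _
      fun x => congrArg Subtype.val x.2
  have hk : Function.Injective k := fun x y hxy =>
    Subtype.ext (Subtype.ext (congrArg (fun z : LinearMap.ker g => (z : L)) hxy))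
  have h1 := h.finrank_range_add_finrank_ker
  have h2 := (LinearMap.range h).finrank_le
  have h3 := LinearMap.finrank_le_finrank_of_injective hk
  omega

variable {ℓ : ℕ}

/-- The total nullity `∑ dim_K ker Φ(F(α_i X))`. -/
def nullity (α : Fin ℓ → L) (F : SkewPoly θ) : ℕ :=
  ∑ i, Module.finrank K (LinearMap.ker (eval θ (α i) F))

theorem nullity_mul_le [FiniteDimensional K L] (α : Fin ℓ → L) (F G : SkewPoly θ) :
    nullity α (F * G) ≤ nullity α F + nullity α G := by
  unfold nullity
  rw [← Finset.sum_add_distrib]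
  exact Finset.sum_le_sum fun i _ => by rw [map_mul]; exact finrank_ker_mul_le _ _

theorem ker_eval_le_ker_eval_mul (α : L) (F G : SkewPoly θ) :
    LinearMap.ker (eval θ α G) ≤ LinearMap.ker (eval θ α (F * G)) := fun x hx => by
  rw [LinearMap.mem_ker, map_mul, Module.End.mul_apply, LinearMap.mem_ker.1 hx, map_zero]

theorem nullity_le_mul [FiniteDimensional K L] (α : Fin ℓ → L) (F G : SkewPoly θ) :
    nullity α G ≤ nullity α (F * G) :=
  Finset.sum_le_sum fun i _ => Submodule.finrank_mono (ker_eval_le_ker_eval_mul (α i) F G)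

theorem nullity_eq_of_eval_eq_zero (α : Fin ℓ → L) {F : SkewPoly θ}
    (h : ∀ i, eval θ (α i) F = 0) : nullity α F = ℓ * Module.finrank K L := by
  rw [nullity, Finset.sum_congr rfl fun i _ => by
    rw [h i, LinearMap.ker_zero, finrank_top], Finset.sum_const, Finset.card_univ,
    Fintype.card_fin, smul_eq_mul]

/-! ### The bound on the total nullity -/

section Galois

variable [FiniteDimensional K L] [IsGalois K L]

omit [FiniteDimensional K L] [IsGalois K L] in
theorem norm_theta (x : L) : Algebra.norm K (θ x) = Algebra.norm K x :=
  Algebra.norm_eq_of_algEquiv θ x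

/-- An element fixed by a generator of the Galois group lies in `K`. -/
theorem exists_algebraMap_eq_of_theta_eq (hθ : ∀ σ : L ≃ₐ[K] L, σ ∈ Subgroup.zpowers θ)
    {x : L} (hx : θ x = x) : ∃ k : K, algebraMap K L k = x := by
  rw [← Set.mem_range, IsGalois.mem_range_algebraMap_iff_fixed]
  intro σ
  have h : θ ∈ MulAction.stabilizer (L ≃ₐ[K] L) x := hx
  exact (Subgroup.zpowers_le.2 h) (hθ σ)

/-- The `j`-th kernel of `X - α_i θ(x)/x` consists of the `y` with `α_j θ(y)/y = α_i θ(x)/x`; taking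
norms forces `j = i`, and then `y/x` is fixed by `θ`. -/
theorem nullity_X_sub_C_le (hθ : ∀ σ : L ≃ₐ[K] L, σ ∈ Subgroup.zpowers θ) (α : Fin ℓ → L)
    (hα : ∀ i, α i ≠ 0) (hinj : Function.Injective fun i => Algebra.norm K (α i))
    {i : Fin ℓ} {x : L} (hx : x ≠ 0) :
    nullity α (SkewPoly.X θ - SkewPoly.C θ (α i * θ x / x)) ≤ 1 := by
  have hθx : θ x ≠ 0 := (map_ne_zero_iff _ θ.injective).2 hx
  have hN : ∀ {y : L}, y ≠ 0 → Algebra.norm K y ≠ 0 := fun h => Algebra.norm_ne_zero_iff.2 h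
  have key : ∀ j, ∀ y ∈ LinearMap.ker (eval θ (α j)
      (SkewPoly.X θ - SkewPoly.C θ (α i * θ x / x))), α j * θ y = α i * θ x / x * y := by
    intro j y hy
    rwa [LinearMap.mem_ker, map_sub, LinearMap.sub_apply, eval_X, eval_C, sub_eq_zero] at hy
  unfold nullity
  rw [Finset.sum_eq_single i]
  · apply finrank_le_one (⟨x, ?_⟩ : LinearMap.ker (eval θ (α i)
      (SkewPoly.X θ - SkewPoly.C θ (α i * θ x / x))))
    · rintro ⟨y, hy⟩
      have h := key i y hy
      obtain ⟨k, hk⟩ := exists_algebraMap_eq_of_theta_eq hθ (x := y / x) (by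
        rw [map_div₀, div_eq_div_iff hθx hx]
        have hi := hα i
        field_simp at h
        linear_combination h)
      refine ⟨k, Subtype.ext ?_⟩
      change k • x = y
      rw [Algebra.smul_def, hk, div_mul_cancel₀ _ hx]
    · rw [LinearMap.mem_ker, map_sub, LinearMap.sub_apply, eval_X, eval_C,
        div_mul_cancel₀ _ hx, sub_self]
  · intro j _ hji
    rw [Submodule.finrank_eq_zero, eq_bot_iff]
    intro y hy
    rw [Submodule.mem_bot]
    by_contra hy0
    have h1 : α j * θ y * x = α i * θ x * y := by
      rw [key j y hy]
      field_simp
    have h := congrArg (Algebra.norm K) h1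
    simp only [map_mul, norm_theta] at h
    apply hji (hinj _)
    apply mul_right_cancel₀ (mul_ne_zero (hN hx) (hN hy0))
    change Algebra.norm K (α j) * _ = Algebra.norm K (α i) * _
    linear_combination h
  · exact fun h => absurd (Finset.mem_univ i) h

/-- A nonzero skew polynomial of degree `d` has total nullity at most `d`. If `x` lies in the
kernel of the `i`-th evaluation, `X - α_i θ(x) / x` can be split off, and by comparing norms its
own kernels have total dimension one. -/
theorem nullity_le_degree (hθ : ∀ σ : L ≃ₐ[K] L, σ ∈ Subgroup.zpowers θ) (α : Fin ℓ → L)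
    (hα : ∀ i, α i ≠ 0) (hinj : Function.Injective fun i => Algebra.norm K (α i))
    {F : SkewPoly θ} (hF : F ≠ 0) : nullity α F ≤ SkewPoly.degree F := by
  induction hd : SkewPoly.degree F generalizing F with
  | zero =>
    have hc := SkewPoly.coeff_degree_ne_zero hF
    have h1 : F = SkewPoly.C θ (SkewPoly.coeff F 0) := by
      conv_lhs => rw [SkewPoly.eq_sum_range (F := F) (N := 1) fun i hi =>
        SkewPoly.coeff_eq_zero_of_degree_lt (by omega)]
      simp
    rw [hd] at hc
    rw [nonpos_iff_eq_zero, nullity, Finset.sum_eq_zero_iff]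
    intro i _
    rw [Submodule.finrank_eq_zero, eq_bot_iff]
    intro y hy
    rw [LinearMap.mem_ker, h1, eval_C] at hy
    exact (mul_eq_zero.1 hy).resolve_left hc
  | succ d ih =>
    by_cases h : ∀ i, LinearMap.ker (eval θ (α i) F) = ⊥
    · have h0 : nullity α F = 0 := Finset.sum_eq_zero fun i _ => by rw [h i, finrank_bot]
      omega
    push Not at h
    obtain ⟨i, hi⟩ := h
    obtain ⟨x, hxF, hx⟩ := Submodule.exists_mem_ne_zero_of_ne_bot hi
    set D := SkewPoly.X θ - SkewPoly.C θ (α i * θ x / x) with hD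
    obtain ⟨hD0, hD1⟩ := SkewPoly.degree_X_pow_sub_algebraMap (θ := θ) one_pos (α i * θ x / x)
    rw [pow_one, ← hD] at hD0 hD1
    obtain ⟨Q, R, hQR, hR⟩ := SkewPoly.exists_eq_mul_add hD0 F
    have hRC : R = SkewPoly.C θ (SkewPoly.coeff R 0) := by
      conv_lhs => rw [SkewPoly.eq_sum_range (F := R) (N := 1) fun i hi => hR i (by omega)]
      simp
    have hDx : eval θ (α i) D x = 0 := by
      rw [hD, map_sub, LinearMap.sub_apply, eval_X, eval_C, div_mul_cancel₀ _ hx, sub_self]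
    have hR0 : R = 0 := by
      rw [LinearMap.mem_ker, hQR, map_add, map_mul, LinearMap.add_apply, Module.End.mul_apply,
        hDx, map_zero, zero_add, hRC, eval_C] at hxF
      rw [hRC, (mul_eq_zero.1 hxF).resolve_right hx, map_zero]
    rw [hR0, add_zero] at hQR
    have hQ0 : Q ≠ 0 := by
      rintro rfl
      exact hF (by rw [hQR, zero_mul])
    have hdeg := (SkewPoly.mul_ne_zero_and_degree_mul hQ0 hD0).2
    rw [← hQR, hd, hD1] at hdeg
    have h1 := ih hQ0 (by omega)
    have h2 := nullity_X_sub_C_le hθ α hα hinj (i := i) hx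
    rw [← hD] at h2
    have h3 := nullity_mul_le α Q D
    rw [← hQR] at h3
    omega

/-- The evaluations of `∑ c_j X^j`, as an `L`-linear function of the coefficients. -/
def evalCoeffs (θ : L ≃ₐ[K] L) (α : Fin ℓ → L) (N : ℕ) :
    (Fin N → L) →ₗ[L] (Fin ℓ → L →ₗ[K] L) where
  toFun c i := eval θ (α i) (∑ j, SkewPoly.C θ (c j) * SkewPoly.X θ ^ (j : ℕ))
  map_add' c d := by
    funext i
    simp only [Pi.add_apply, map_add, add_mul, Finset.sum_add_distrib]
  map_smul' a c := by
    funext i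
    ext x
    simp only [map_sum, Pi.smul_apply, smul_eq_mul, map_mul, LinearMap.sum_apply,
      Module.End.mul_apply, eval_C, RingHom.id_apply, LinearMap.smul_apply, Finset.mul_sum,
      mul_assoc]

omit [FiniteDimensional K L] [IsGalois K L] in
theorem coeff_sum_fin {N : ℕ} (c : Fin N → L) (k : ℕ) :
    SkewPoly.coeff (∑ j, SkewPoly.C θ (c j) * SkewPoly.X θ ^ (j : ℕ)) k =
      if h : k < N then c ⟨k, h⟩ else 0 := by
  rw [SkewPoly.coeff_sum]
  simp only [SkewPoly.coeff_C_mul_X_pow]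
  split_ifs with h
  · rw [Finset.sum_eq_single ⟨k, h⟩]
    · simp
    · intro j _ hj
      rw [if_neg fun hjk => hj (Fin.ext hjk)]
    · simp
  · refine Finset.sum_eq_zero fun j _ => if_neg ?_
    have := j.2
    omega

/-- There is a nonzero skew polynomial of degree at most `∑ dim U_i` whose `i`-th evaluation
vanishes on `U_i`: vanishing amounts to `∑ dim U_i` linear conditions on the coefficients. -/
theorem exists_ne_zero_forall_le_ker (α : Fin ℓ → L) (U : Fin ℓ → Submodule K L) :
    ∃ P : SkewPoly θ, P ≠ 0 ∧ SkewPoly.degree P ≤ ∑ i, Module.finrank K (U i) ∧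
      ∀ i, U i ≤ LinearMap.ker (eval θ (α i) P) := by
  set d := ∑ i, Module.finrank K (U i) with hd
  let r : (Fin ℓ → L →ₗ[K] L) →ₗ[L] ((i : Fin ℓ) → U i →ₗ[K] L) :=
    { toFun := fun f i => (f i).comp (U i).subtype
      map_add' := fun _ _ => rfl
      map_smul' := fun _ _ => rfl }
  have hfr : Module.finrank L ((i : Fin ℓ) → U i →ₗ[K] L) = d := by
    rw [Module.finrank_pi_fintype]
    exact Finset.sum_congr rfl fun i _ => Module.finrank_linearMap_self _ _ _
  have hker := LinearMap.ker_ne_bot_of_finrank_lt (f := r ∘ₗ evalCoeffs θ α (d + 1)) (by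
    rw [hfr, Module.finrank_fin_fun]; omega)
  obtain ⟨c, hc, hc0⟩ := Submodule.exists_mem_ne_zero_of_ne_bot hker
  refine ⟨∑ j, SkewPoly.C θ (c j) * SkewPoly.X θ ^ (j : ℕ), fun h0 => hc0 ?_, ?_, ?_⟩
  · funext j
    have h := coeff_sum_fin (θ := θ) c j
    rw [h0, SkewPoly.coeff_zero, dif_pos j.2] at h
    exact h.symm
  · exact SkewPoly.degree_le fun k hk => by rw [coeff_sum_fin, dif_neg (by omega)]
  · intro i x hx
    exact LinearMap.congr_fun (congrFun hc i) ⟨x, hx⟩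

omit [FiniteDimensional K L] [IsGalois K L] in
theorem norm_injective {α : Fin ℓ → L} {lam : Fin ℓ → K}
    (hlam : ∀ i, lam i = Algebra.norm K (α i)) (hinj : Function.Injective lam) :
    Function.Injective fun i => Algebra.norm K (α i) := by
  simpa only [← hlam] using hinj

/-! ### The sum-rank weight as a sum of ranks -/

section Weight

variable (hθ : ∀ σ : L ≃ₐ[K] L, σ ∈ Subgroup.zpowers θ) (α : Fin ℓ → L)
  (hα : ∀ i, α i ≠ 0) (lam : Fin ℓ → K) (hlam : ∀ i, lam i = Algebra.norm K (α i))
  (hinj : Function.Injective lam)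
include hθ hlam

theorem eval_hPoly (i : Fin ℓ) : eval θ (α i) (hPoly θ lam) = 0 := by
  have h := PhiVec_eq_zero θ hθ lam α (fun i => ⟨i, hlam i⟩) (hPoly θ lam)
    (Ideal.subset_span rfl)
  have h1 : Phi θ (SkewPoly.scale θ (α i) (hPoly θ lam)) = 0 := congrFun h i
  simp only [eval, RingHom.comp_apply]
  rw [h1, map_zero]

theorem nullity_hPoly : nullity α (hPoly θ lam) = ℓ * Module.finrank K L :=
  nullity_eq_of_eval_eq_zero α (eval_hPoly hθ α lam hlam)

include hα hinj

/-- The degree of the greatest common right divisor with `H_Λ` is the total nullity: a right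
divisor of `H_Λ` attains the bound `nullity_le_degree`, and conversely the skew polynomial of least
degree that vanishes on all the kernels of `F` divides both `F` and `H_Λ`. -/
theorem degGcrd_hPoly (F : SkewPoly θ) :
    SkewPoly.degGcrd F (hPoly θ lam) = nullity α F := by
  have hN := norm_injective hlam hinj
  obtain ⟨hH0, hHd⟩ := SkewPoly.degree_hPoly (θ := θ) lam
  have hnH := nullity_hPoly hθ α lam hlam
  apply IsGreatest.csSup_eq
  constructor
  · obtain ⟨P, hP0, hPd, hP⟩ := exists_ne_zero_forall_le_ker (θ := θ) α
      (fun i => LinearMap.ker (eval θ (α i) F))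
    have hPn : nullity α F ≤ nullity α P :=
      Finset.sum_le_sum fun i _ => Submodule.finrank_mono (hP i)
    have hPb := nullity_le_degree hθ α hα hN hP0
    have hPd' : SkewPoly.degree P = nullity α F := le_antisymm hPd (hPn.trans hPb)
    have hker : ∀ i, LinearMap.ker (eval θ (α i) F) = LinearMap.ker (eval θ (α i) P) := by
      intro i
      refine Submodule.eq_of_le_of_finrank_le (hP i) ?_
      by_contra hlt
      have : nullity α F < nullity α P := Finset.sum_lt_sum
        (fun j _ => Submodule.finrank_mono (hP j)) ⟨i, Finset.mem_univ i, not_le.1 hlt⟩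
      omega
    -- A remainder modulo `P` vanishes on the kernels of `P` and has smaller degree.
    have hdvd : ∀ G : SkewPoly θ,
        (∀ i, LinearMap.ker (eval θ (α i) P) ≤ LinearMap.ker (eval θ (α i) G)) →
        SkewPoly.RightDvd P G := by
      intro G hG
      obtain ⟨Q, R, hQR, hR⟩ := SkewPoly.exists_eq_mul_add hP0 G
      have hR0 : R = 0 := by
        by_contra hR0
        have h1 := nullity_le_degree hθ α hα hN hR0
        have h2 : nullity α P ≤ nullity α R := by
          refine Finset.sum_le_sum fun i _ => Submodule.finrank_mono fun x hx => ?_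
          have h3 := hG i hx
          have h4 := ker_eval_le_ker_eval_mul (α i) Q P hx
          rw [LinearMap.mem_ker] at h3 h4 ⊢
          rwa [hQR, map_add, LinearMap.add_apply, h4, zero_add] at h3
        exact SkewPoly.coeff_degree_ne_zero hR0 (hR _ (by omega))
      exact ⟨Q, by rw [hQR, hR0, add_zero]⟩
    refine ⟨P, hdvd F fun i => (hker i).ge, hdvd _ fun i => ?_, hPd'⟩
    rw [eval_hPoly hθ α lam hlam, LinearMap.ker_zero]
    exact le_top
  · -- If `H_Λ = Q D`, the nullities of `Q` and `D` add up to at least `ℓ n = deg Q + deg D`, so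
    -- that the nullity of `D` is at least its degree.
    rintro _ ⟨D, ⟨A, rfl⟩, ⟨Q, hQ⟩, rfl⟩
    have hQ0 : Q ≠ 0 := by
      rintro rfl
      exact hH0 (by rw [hQ, zero_mul])
    have hD0 : D ≠ 0 := by
      rintro rfl
      exact hH0 (by rw [hQ, mul_zero])
    have h1 := (SkewPoly.mul_ne_zero_and_degree_mul hQ0 hD0).2
    have h2 := nullity_mul_le α Q D
    have h3 := nullity_le_degree hθ α hα hN hQ0
    have h4 := nullity_le_mul α A D
    rw [← hQ] at h1 h2
    omega

/-- The sum-rank weight is the sum of the ranks of the evaluations. -/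
theorem weight_mk (F : SkewPoly θ) :
    weight θ lam (Ideal.Quotient.mk (hIdeal θ lam) F) =
      ∑ i, Module.finrank K (LinearMap.range (eval θ (α i) F)) := by
  change ℓ * Module.finrank K L - SkewPoly.degGcrd F (hPoly θ lam) = _
  rw [degGcrd_hPoly hθ α hα lam hlam hinj, Nat.sub_eq_iff_eq_add, nullity,
    ← Finset.sum_add_distrib]
  · simp only [LinearMap.finrank_range_add_finrank_ker, Finset.sum_const, Finset.card_univ,
      Fintype.card_fin, smul_eq_mul]
  · rw [← nullity_eq_of_eval_eq_zero (θ := θ) α (F := 0) fun i => map_zero _]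
    refine Finset.sum_le_sum fun i _ => Submodule.finrank_mono ?_
    rw [map_zero, LinearMap.ker_zero]
    exact le_top

/-- A skew polynomial all of whose evaluations vanish is a multiple of `H_Λ`. -/
theorem mem_hIdeal_of_eval_eq_zero (F : SkewPoly θ) (hF : ∀ i, eval θ (α i) F = 0) :
    F ∈ hIdeal θ lam := by
  have hN := norm_injective hlam hinj
  obtain ⟨hH0, hHd⟩ := SkewPoly.degree_hPoly (θ := θ) lam
  obtain ⟨Q, R, hQR, hR⟩ := SkewPoly.exists_eq_mul_add hH0 F
  have hR0 : R = 0 := by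
    by_contra hR0
    have h1 := nullity_le_degree hθ α hα hN hR0
    have h2 : nullity α R = ℓ * Module.finrank K L := by
      refine nullity_eq_of_eval_eq_zero α fun i => ?_
      have h3 := hF i
      rwa [hQR, map_add, map_mul, eval_hPoly hθ α lam hlam, mul_zero, zero_add] at h3
    exact SkewPoly.coeff_degree_ne_zero hR0 (hR _ (by omega))
  exact mem_hIdeal.2 ⟨Q, by rw [hQR, hR0, add_zero]⟩

/-- Any tuple of endomorphisms of `L` is the tuple of evaluations of a skew polynomial. -/
theorem exists_eval_eq (f : Fin ℓ → Module.End K L) :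
    ∃ F : SkewPoly θ, ∀ i, eval θ (α i) F = f i := by
  have hN := norm_injective hlam hinj
  have hfr : Module.finrank L (Fin (ℓ * Module.finrank K L) → L) =
      Module.finrank L (Fin ℓ → L →ₗ[K] L) := by
    have : Module.Finite L (L →ₗ[K] L) := Module.Finite.linearMap K L L L
    rw [Module.finrank_fin_fun, Module.finrank_pi_fintype]
    simp only [Module.finrank_linearMap_self, Finset.sum_const, Finset.card_univ,
      Fintype.card_fin, smul_eq_mul]
  have hinj' : Function.Injective (evalCoeffs θ α (ℓ * Module.finrank K L)) := by
    rw [injective_iff_map_eq_zero]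
    intro c hc
    have h0 : (∑ j, SkewPoly.C θ (c j) * SkewPoly.X θ ^ (j : ℕ) : SkewPoly θ) = 0 := by
      by_contra h0
      have h1 := nullity_le_degree hθ α hα hN h0
      have h2 : nullity α (∑ j, SkewPoly.C θ (c j) * SkewPoly.X θ ^ (j : ℕ)) =
          ℓ * Module.finrank K L :=
        nullity_eq_of_eval_eq_zero α (congrFun hc)
      apply SkewPoly.coeff_degree_ne_zero h0
      rw [coeff_sum_fin, dif_neg (by omega)]
    funext j
    have h := coeff_sum_fin (θ := θ) c j
    rw [h0, SkewPoly.coeff_zero, dif_pos j.2] at h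
    exact h.symm
  obtain ⟨c, hc⟩ := (LinearMap.injective_iff_surjective_of_finrank_eq_finrank hfr).1 hinj' f
  exact ⟨_, congrFun hc⟩

end Weight

end Galois

open Matrix

/-! ### Spaces of matrices of rank at most one -/

open Matrix

section RankOne

variable {K ι κ W : Type*} [Field K]

theorem exists_eq_vecMulVec_of_rank_le_one [Fintype ι] [DecidableEq ι] {A : Matrix κ ι K}
    [Fintype κ] (h : A.rank ≤ 1) : ∃ u v, A = vecMulVec u v := by
  obtain ⟨u, hu⟩ := finrank_le_one_iff.1 h
  choose c hc using fun j => hu ⟨A *ᵥ Pi.single j 1, ⟨_, rfl⟩⟩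
  refine ⟨u, c, ?_⟩
  ext i j
  have h1 := congrFun (congrArg Subtype.val (hc j)) i
  simp only [mulVec_single_one, Submodule.coe_smul, Pi.smul_apply, smul_eq_mul, col_apply] at h1
  rw [vecMulVec_apply, ← h1, mul_comm]

theorem exists_smul_of_minors {u a : κ → K} (hu : u ≠ 0)
    (h : ∀ i k, u i * a k = a i * u k) : ∃ c : K, a = c • u := by
  obtain ⟨k, hk⟩ := Function.ne_iff.1 hu
  refine ⟨a k / u k, funext fun i => ?_⟩
  have hk' : u k ≠ 0 := hk
  rw [Pi.smul_apply, smul_eq_mul, div_mul_eq_mul_div, eq_div_iff hk', ← h i k, mul_comm]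

theorem exists_smul_of_vecMulVec_eq {u a : κ → K} {v b : ι → K} (hu : vecMulVec u v ≠ 0)
    (h : vecMulVec u v = vecMulVec a b) : ∃ c : K, a = c • u := by
  have hb : b ≠ 0 := by
    rintro rfl
    exact hu (h.trans (by ext i j; simp [vecMulVec_apply]))
  have hu' : u ≠ 0 := by
    rintro rfl
    exact hu (zero_vecMulVec v)
  obtain ⟨j, hj⟩ := Function.ne_iff.1 hb
  have hj' : b j ≠ 0 := hj
  have key : ∀ i, u i * v j = a i * b j := fun i => by
    simpa only [vecMulVec_apply] using congrFun (congrFun h i) j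
  refine exists_smul_of_minors hu' fun i k => ?_
  apply mul_right_cancel₀ hj'
  linear_combination (-u i) * key k + u k * key i

/-- If a sum of two rank one matrices has rank at most one, then they have proportional
column spaces or proportional row spaces. -/
theorem exists_smul_or_exists_smul_of_rank_add_le_one [Fintype ι] [DecidableEq ι] [Fintype κ]
    {u a : κ → K} {v b : ι → K} (h0 : vecMulVec u v ≠ 0)
    (h : (vecMulVec u v + vecMulVec a b).rank ≤ 1) :
    (∃ c : K, a = c • u) ∨ ∃ c : K, b = c • v := by
  obtain ⟨p, q, hpq⟩ := exists_eq_vecMulVec_of_rank_le_one h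
  have e : ∀ i j, u i * v j + a i * b j = p i * q j := fun i j => congrFun (congrFun hpq i) j
  have hu : u ≠ 0 := by
    rintro rfl
    exact h0 (zero_vecMulVec v)
  have hv : v ≠ 0 := by
    rintro rfl
    exact h0 (by ext i j; simp [vecMulVec_apply])
  -- The `2 × 2` minors of `u vᵀ + a bᵀ` are products of minors of `(u, a)` and of `(v, b)`.
  have minor : ∀ i k j l, (u i * a k - a i * u k) * (v j * b l - b j * v l) = 0 := by
    intro i k j l
    linear_combination e i j * (u k * v l + a k * b l) + p i * q j * e k l -
      e i l * (u k * v j + a k * b j) - p i * q l * e k j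
  by_cases hm : ∀ i k, u i * a k = a i * u k
  · exact Or.inl (exists_smul_of_minors hu hm)
  · push Not at hm
    obtain ⟨i, k, hik⟩ := hm
    exact Or.inr (exists_smul_of_minors hv fun j l =>
      sub_eq_zero.1 ((mul_eq_zero.1 (minor i k j l)).resolve_left (sub_ne_zero.2 hik)))

variable [AddCommGroup W] [Module K W]

/-- All values of `f` have their columns in a common line. -/
def CommonColumn (f : W →ₗ[K] Matrix κ ι K) : Prop := ∃ u, ∀ y, ∃ g, f y = vecMulVec u g

/-- All values of `f` have their rows in a common line. -/
def CommonRow (f : W →ₗ[K] Matrix κ ι K) : Prop := ∃ v, ∀ y, ∃ g, f y = vecMulVec g v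

/-- A linear space of matrices of rank at most one has a common column or a common row: both
conditions relative to one fixed nonzero member define subspaces, whose union is everything. -/
theorem commonColumn_or_commonRow [Fintype ι] [DecidableEq ι] [Fintype κ]
    (f : W →ₗ[K] Matrix κ ι K) (hf : ∀ y, (f y).rank ≤ 1) : CommonColumn f ∨ CommonRow f := by
  by_cases h0 : ∀ y, f y = 0
  · exact Or.inl ⟨0, fun y => ⟨0, by rw [h0, zero_vecMulVec]⟩⟩
  push Not at h0
  obtain ⟨y₀, hy₀⟩ := h0
  obtain ⟨u, v, huv⟩ := exists_eq_vecMulVec_of_rank_le_one (hf y₀)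
  rw [huv] at hy₀
  have key : ∀ y, (∃ g, f y = vecMulVec u g) ∨ ∃ g, f y = vecMulVec g v := by
    intro y
    obtain ⟨a, b, hab⟩ := exists_eq_vecMulVec_of_rank_le_one (hf y)
    have h := hf (y₀ + y)
    rw [map_add, huv, hab] at h
    rcases exists_smul_or_exists_smul_of_rank_add_le_one hy₀ h with ⟨c, rfl⟩ | ⟨c, rfl⟩
    · exact Or.inl ⟨c • b, by rw [hab, smul_vecMulVec, vecMulVec_smul]⟩
    · exact Or.inr ⟨c • a, by rw [hab, smul_vecMulVec, vecMulVec_smul]⟩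
  by_contra hcon
  rw [not_or] at hcon
  obtain ⟨h1, h2⟩ := hcon
  have h1' : ∃ y, ¬ ∃ g, f y = vecMulVec u g := by
    by_contra h
    push Not at h
    exact h1 ⟨u, h⟩
  have h2' : ∃ y, ¬ ∃ g, f y = vecMulVec g v := by
    by_contra h
    push Not at h
    exact h2 ⟨v, h⟩
  obtain ⟨y, hy⟩ := h1'
  obtain ⟨z, hz⟩ := h2'
  obtain ⟨g, hg⟩ := (key y).resolve_left hy
  obtain ⟨k, hk⟩ := (key z).resolve_right hz
  rcases key (y + z) with ⟨w, hw⟩ | ⟨w, hw⟩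
  · refine hy ⟨w - k, ?_⟩
    rw [vecMulVec_sub, ← hw, ← hk, map_add, add_sub_cancel_right]
  · refine hz ⟨w - g, ?_⟩
    rw [sub_vecMulVec, ← hw, ← hg, map_add, add_sub_cancel_left]

/-- The vectors multiplying the common column depend linearly on the parameter. -/
theorem CommonColumn.exists_linearMap {f : W →ₗ[K] Matrix κ ι K} (hf : CommonColumn f)
    (h0 : f ≠ 0) : ∃ u, u ≠ 0 ∧ ∃ g : W →ₗ[K] (ι → K), ∀ y, f y = vecMulVec u (g y) := by
  obtain ⟨u, hu⟩ := hf
  have hu0 : u ≠ 0 := by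
    rintro rfl
    refine h0 (LinearMap.ext fun y => ?_)
    obtain ⟨g, hg⟩ := hu y
    rw [hg, zero_vecMulVec, LinearMap.zero_apply]
  obtain ⟨k, hk⟩ := Function.ne_iff.1 hu0
  have hk' : u k ≠ 0 := hk
  refine ⟨u, hu0, ⟨⟨fun y => (u k)⁻¹ • f y k, fun y z => ?_⟩, fun c y => ?_⟩, fun y => ?_⟩
  · rw [map_add, ← smul_add]
    rfl
  · change (u k)⁻¹ • f (c • y) k = c • ((u k)⁻¹ • f y k)
    rw [map_smul, smul_comm c]
    rfl
  · obtain ⟨g, hg⟩ := hu y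
    change f y = vecMulVec u ((u k)⁻¹ • f y k)
    ext i j
    simp only [hg, vecMulVec_apply, Pi.smul_apply, smul_eq_mul]
    rw [inv_mul_cancel_left₀ hk']

/-- The vectors multiplying the common row depend linearly on the parameter. -/
theorem CommonRow.exists_linearMap {f : W →ₗ[K] Matrix κ ι K} (hf : CommonRow f)
    (h0 : f ≠ 0) : ∃ v, v ≠ 0 ∧ ∃ h : W →ₗ[K] (κ → K), ∀ x, f x = vecMulVec (h x) v := by
  have hT : ∀ (x : κ → K) (v : ι → K), (vecMulVec x v)ᵀ = vecMulVec v x :=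
    fun x v => transpose_vecMulVec x v
  obtain ⟨v, hv⟩ := hf
  have hc : CommonColumn ((transposeLinearEquiv κ ι K K).toLinearMap ∘ₗ f) :=
    ⟨v, fun x => (hv x).imp fun g hg => by
      rw [← hT, ← hg]
      rfl⟩
  obtain ⟨v', hv', h, hh⟩ := hc.exists_linearMap fun h => h0 (LinearMap.ext fun x =>
    transpose_injective (LinearMap.congr_fun h x))
  refine ⟨v', hv', h, fun x => transpose_injective ?_⟩
  rw [hT, ← hh]
  rfl

end RankOne

/-! ### Linear maps preserving rank one matrices -/

section SingleBlock

variable {K ι : Type*} [Field K] [Fintype ι] [DecidableEq ι]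

omit [DecidableEq ι] in
theorem vecMulVec_mul_transpose (M N : Matrix ι ι K) (x y : ι → K) :
    vecMulVec (M *ᵥ x) (N *ᵥ y) = M * vecMulVec x y * Nᵀ := by
  rw [mul_vecMulVec, vecMulVec_mul, vecMul_transpose]

theorem map_eq_sum_single {W : Type*} [AddCommGroup W] [Module K W]
    (ψ : Matrix ι ι K →ₗ[K] W) (X : Matrix ι ι K) :
    ψ X = ∑ i, ∑ j, X i j • ψ (single i j 1) := by
  conv_lhs => rw [matrix_eq_sum_single X]
  simp only [map_sum]
  refine Finset.sum_congr rfl fun i _ => Finset.sum_congr rfl fun j _ => ?_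
  rw [← map_smul, smul_single, smul_eq_mul, mul_one]

theorem map_eq_zero_of_vecMulVec {W : Type*} [AddCommGroup W] [Module K W]
    (ψ : Matrix ι ι K →ₗ[K] W) (h : ∀ x y, ψ (vecMulVec x y) = 0) (X : Matrix ι ι K) :
    ψ X = 0 := by
  rw [map_eq_sum_single]
  refine Finset.sum_eq_zero fun i _ => Finset.sum_eq_zero fun j _ => ?_
  rw [single_eq_single_vecMulVec_single, h, smul_zero]

/-- A linear map for which all rank one matrices are eigenvectors is scalar. The common
eigenvalue is the one of the all-ones matrix. -/
theorem exists_forall_eq_smul (ψ : Matrix ι ι K →ₗ[K] Matrix ι ι K)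
    (h : ∀ x y, ∃ c : K, ψ (vecMulVec x y) = c • vecMulVec x y) : ∃ c : K, ∀ X, ψ X = c • X := by
  obtain ⟨c, hc⟩ := h 1 1
  choose d hd using fun i j : ι => h (Pi.single i 1) (Pi.single j 1)
  simp only [← single_eq_single_vecMulVec_single] at hd
  have key : ∀ i j, d i j = c := by
    intro i j
    have h1 := congrFun (congrFun hc i) j
    rw [map_eq_sum_single] at h1
    simpa [hd, Matrix.sum_apply, vecMulVec_apply, single_apply, Finset.sum_ite_eq, ite_and] using h1
  refine ⟨c, fun X => ?_⟩
  rw [map_eq_sum_single]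
  conv_rhs => rw [matrix_eq_sum_single X, Finset.smul_sum]
  refine Finset.sum_congr rfl fun i _ => ?_
  rw [Finset.smul_sum]
  refine Finset.sum_congr rfl fun j _ => ?_
  rw [hd, key, smul_single, smul_single, smul_single]
  simp [mul_comm]

variable (ψ : Matrix ι ι K →ₗ[K] Matrix ι ι K)

/-- The map `y ↦ ψ(x yᵀ)`. -/
def fixLeft (x : ι → K) : (ι → K) →ₗ[K] Matrix ι ι K := ψ ∘ₗ vecMulVecBilin K K x

/-- The map `x ↦ ψ(x yᵀ)`. -/
def fixRight (y : ι → K) : (ι → K) →ₗ[K] Matrix ι ι K := ψ ∘ₗ (vecMulVecBilin K K).flip y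

variable {ψ}

omit [Fintype ι] [DecidableEq ι] in
theorem fixLeft_apply (x y : ι → K) : fixLeft ψ x y = ψ (vecMulVec x y) := rfl

omit [Fintype ι] [DecidableEq ι] in
theorem fixRight_apply (x y : ι → K) : fixRight ψ y x = ψ (vecMulVec x y) := rfl

variable [Nonempty ι] (hinj : Function.Injective ψ)
  (hrank : ∀ X, X.rank ≤ 1 → (ψ X).rank ≤ 1)

include hinj

omit [Fintype ι] [DecidableEq ι] [Nonempty ι] in
theorem map_vecMulVec_ne_zero {x y : ι → K} (hx : x ≠ 0) (hy : y ≠ 0) :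
    ψ (vecMulVec x y) ≠ 0 := fun h => by
  rw [map_eq_zero_iff ψ hinj, vecMulVec_eq_zero] at h
  exact h.elim hx hy

omit [Fintype ι] [DecidableEq ι] in
theorem fixLeft_ne_zero {x : ι → K} (hx : x ≠ 0) : fixLeft ψ x ≠ 0 := fun h =>
  map_vecMulVec_ne_zero hinj hx one_ne_zero (LinearMap.congr_fun h 1)

omit [Fintype ι] [DecidableEq ι] in
theorem fixRight_ne_zero {y : ι → K} (hy : y ≠ 0) : fixRight ψ y ≠ 0 := fun h =>
  map_vecMulVec_ne_zero hinj one_ne_zero hy (LinearMap.congr_fun h 1)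

include hrank

omit [DecidableEq ι] [Nonempty ι] hinj in
theorem rank_fixLeft_le (x y : ι → K) : (fixLeft ψ x y).rank ≤ 1 :=
  hrank _ (rank_vecMulVec_le x y)

/-- Either all the spaces `ψ(x Kⁿ)` have a common column, or all have a common row: spaces
`u Kⁿ` and `Kⁿ vᵀ` of different kinds meet in `u vᵀ`. -/
theorem forall_commonColumn_or_forall_commonRow :
    (∀ x, CommonColumn (fixLeft ψ x)) ∨ ∀ x, CommonRow (fixLeft ψ x) := by
  by_contra hcon
  push Not at hcon
  obtain ⟨⟨x₁, h₁⟩, ⟨x₂, h₂⟩⟩ := hcon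
  have hr₁ := (commonColumn_or_commonRow _ (rank_fixLeft_le hrank x₁)).resolve_left h₁
  have hc₂ := (commonColumn_or_commonRow _ (rank_fixLeft_le hrank x₂)).resolve_right h₂
  have hx₁ : x₁ ≠ 0 := by
    rintro rfl
    exact h₁ ⟨0, fun y => ⟨0, by rw [fixLeft_apply, zero_vecMulVec, map_zero, zero_vecMulVec]⟩⟩
  have hx₂ : x₂ ≠ 0 := by
    rintro rfl
    exact h₂ ⟨0, fun y => ⟨0, by rw [fixLeft_apply, zero_vecMulVec, map_zero, zero_vecMulVec]⟩⟩
  obtain ⟨v, hv, h, hh⟩ := hr₁.exists_linearMap (fixLeft_ne_zero hinj hx₁)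
  obtain ⟨u, hu, g, hg⟩ := hc₂.exists_linearMap (fixLeft_ne_zero hinj hx₂)
  have hhs : Function.Surjective h := by
    rw [← LinearMap.injective_iff_surjective, injective_iff_map_eq_zero]
    intro y hy
    by_contra hy0
    exact map_vecMulVec_ne_zero hinj hx₁ hy0 (by rw [← fixLeft_apply, hh, hy, zero_vecMulVec])
  have hgs : Function.Surjective g := by
    rw [← LinearMap.injective_iff_surjective, injective_iff_map_eq_zero]
    intro y hy
    by_contra hy0
    exact map_vecMulVec_ne_zero hinj hx₂ hy0 (by rw [← fixLeft_apply, hg, hy, vecMulVec_zero])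
  obtain ⟨y₁, hy₁⟩ := hhs u
  obtain ⟨y₂, hy₂⟩ := hgs v
  have e : ψ (vecMulVec x₂ y₂) = ψ (vecMulVec x₁ y₁) := by
    rw [← fixLeft_apply, ← fixLeft_apply, hh, hg, hy₁, hy₂]
  have hne : vecMulVec x₂ y₂ ≠ 0 := fun h0 => by
    have h1 := hg y₂
    rw [fixLeft_apply, h0, map_zero, hy₂, eq_comm, vecMulVec_eq_zero] at h1
    exact h1.elim hu hv
  obtain ⟨c, rfl⟩ := exists_smul_of_vecMulVec_eq hne (hinj e)
  refine h₁ ⟨u, fun y => ⟨c • g y, ?_⟩⟩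
  rw [fixLeft_apply, smul_vecMulVec, map_smul, ← fixLeft_apply, hg, vecMulVec_smul]

/-- If the spaces `ψ(x Kⁿ)` have common columns, then the spaces `ψ(Kⁿ yᵀ)` have common rows:
otherwise all the values of `ψ` would have columns in one line. -/
theorem commonRow_fixRight (hcol : ∀ x, CommonColumn (fixLeft ψ x)) (y : ι → K) :
    CommonRow (fixRight ψ y) := by
  by_cases hy : y = 0
  · subst hy
    exact ⟨0, fun x => ⟨0, by rw [fixRight_apply, vecMulVec_zero, map_zero, vecMulVec_zero]⟩⟩
  refine (commonColumn_or_commonRow (fixRight ψ y) fun x => hrank _ (rank_vecMulVec_le x y)).elim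
    (fun h => ?_) id
  obtain ⟨u, hu0, g, hg⟩ := h.exists_linearMap (fixRight_ne_zero hinj hy)
  have himage : ∀ x z, ∃ w, ψ (vecMulVec x z) = vecMulVec u w := by
    intro x z
    by_cases hx : x = 0
    · exact ⟨0, by rw [hx, zero_vecMulVec, map_zero, vecMulVec_zero]⟩
    obtain ⟨a, ha⟩ := hcol x
    obtain ⟨b, hb⟩ := ha y
    obtain ⟨b', hb'⟩ := ha z
    have hne := map_vecMulVec_ne_zero hinj hx hy
    rw [← fixRight_apply, hg] at hne
    obtain ⟨c, rfl⟩ := exists_smul_of_vecMulVec_eq hne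
      (((hg x).symm.trans (fixRight_apply x y)).trans hb)
    exact ⟨c • b', by rw [← fixLeft_apply, hb', smul_vecMulVec, vecMulVec_smul]⟩
  -- Being of the form `u wᵀ` is expressed by linear equations, so it extends from the rank one
  -- matrices to all of them.
  let minors : Matrix ι ι K →ₗ[K] (ι → ι → ι → K) :=
    { toFun := fun A i k j => u i * A k j - A i j * u k
      map_add' := fun A B => by
        funext i k j
        simp only [Matrix.add_apply, Pi.add_apply]
        ring
      map_smul' := fun c A => by
        funext i k j
        simp only [Matrix.smul_apply, Pi.smul_apply, smul_eq_mul, RingHom.id_apply]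
        ring }
  have hminors : ∀ A, minors A = 0 := by
    intro A
    obtain ⟨X, rfl⟩ := LinearMap.injective_iff_surjective.1 hinj A
    refine map_eq_zero_of_vecMulVec (minors ∘ₗ ψ) (fun x z => ?_) X
    obtain ⟨w, hw⟩ := himage x z
    funext i k j
    change u i * ψ (vecMulVec x z) k j - ψ (vecMulVec x z) i j * u k = 0
    rw [hw, vecMulVec_apply, vecMulVec_apply]
    ring
  -- Since `ψ` is onto, every vector is a multiple of `u`, which is only possible for `1 × 1`
  -- matrices; a common column is then also a common row.
  have hpar : ∀ w : ι → K, ∃ c : K, w = c • u := by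
    intro w
    refine exists_smul_of_minors hu0 fun i k => ?_
    have h1 : u i * vecMulVec w 1 k i - vecMulVec w 1 i i * u k = 0 :=
      congrFun (congrFun (congrFun (hminors (vecMulVec w 1)) i) k) i
    simpa [vecMulVec_apply, sub_eq_zero] using h1
  refine ⟨u, fun x => ?_⟩
  obtain ⟨c, hc⟩ := hpar (g x)
  exact ⟨c • u, by rw [hg, hc, vecMulVec_smul, smul_vecMulVec]⟩

/-- With `ψ(x 1ᵀ) = h(x) vᵀ` and `ψ(1 yᵀ) = u g(y)ᵀ` for linear `g` and `h`, the common columns and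
rows show that `ψ(x yᵀ)` is a multiple of `h(x) g(y)ᵀ`. So rank one matrices are eigenvectors after
multiplication by the inverses of the matrices of `h` and `g`. -/
theorem exists_eq_mul_mul_transpose (hcol : ∀ x, CommonColumn (fixLeft ψ x)) :
    ∃ M N : GL ι K, ∀ X, ψ X = (M : Matrix ι ι K) * X * (N : Matrix ι ι K)ᵀ := by
  have h1 : (1 : ι → K) ≠ 0 := one_ne_zero
  have hrow := commonRow_fixRight hinj hrank hcol
  obtain ⟨v, hv, h, hh⟩ := (hrow 1).exists_linearMap (fixRight_ne_zero hinj h1)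
  obtain ⟨u, hu, g, hg⟩ := (hcol 1).exists_linearMap (fixLeft_ne_zero hinj h1)
  have hhi : Function.Injective h := by
    rw [injective_iff_map_eq_zero]
    intro x hx
    by_contra hx0
    exact map_vecMulVec_ne_zero hinj hx0 h1 (by rw [← fixRight_apply, hh, hx, zero_vecMulVec])
  have hgi : Function.Injective g := by
    rw [injective_iff_map_eq_zero]
    intro y hy
    by_contra hy0
    exact map_vecMulVec_ne_zero hinj h1 hy0 (by rw [← fixLeft_apply, hg, hy, vecMulVec_zero])
  have key : ∀ x y, ∃ c : K, ψ (vecMulVec x y) = c • vecMulVec (h x) (g y) := by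
    intro x y
    by_cases hx : x = 0
    · exact ⟨0, by rw [hx, zero_vecMulVec, map_zero, zero_smul]⟩
    by_cases hy : y = 0
    · exact ⟨0, by rw [hy, vecMulVec_zero, map_zero, zero_smul]⟩
    obtain ⟨a, ha⟩ := hcol x
    obtain ⟨b, hb⟩ := hrow y
    obtain ⟨p, hp⟩ := ha y
    obtain ⟨p', hp'⟩ := ha 1
    obtain ⟨q, hq⟩ := hb x
    obtain ⟨q', hq'⟩ := hb 1
    rw [fixLeft_apply] at hp hp'
    rw [fixRight_apply] at hq hq'
    have hne1 := map_vecMulVec_ne_zero hinj hx h1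
    have hne2 := map_vecMulVec_ne_zero hinj h1 hy
    have e1 : vecMulVec (h x) v = vecMulVec a p' := by rw [← hh, fixRight_apply, hp']
    have e2 : vecMulVec u (g y) = vecMulVec q' b := by rw [← hg, fixLeft_apply, hq']
    rw [← fixRight_apply, hh] at hne1
    rw [← fixLeft_apply, hg] at hne2
    obtain ⟨c, rfl⟩ := exists_smul_of_vecMulVec_eq hne1 e1
    have e2' := congrArg transpose e2
    rw [transpose_vecMulVec, transpose_vecMulVec] at e2'
    obtain ⟨d, rfl⟩ := exists_smul_of_vecMulVec_eq
      (fun h0 => hne2 (transpose_injective (by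
        rw [transpose_vecMulVec, h0, transpose_zero]))) e2'
    have hne3 := map_vecMulVec_ne_zero hinj hx hy
    rw [hp] at hne3
    obtain ⟨t, rfl⟩ := exists_smul_of_vecMulVec_eq hne3 (hp.symm.trans hq)
    exact ⟨t * c * d, by
      rw [hq, smul_smul, smul_vecMulVec, vecMulVec_smul, smul_smul]⟩
  have hM : IsUnit (LinearMap.toMatrix' h) := mulVec_injective_iff_isUnit.1 (by
    intro x y hxy
    simp only [LinearMap.toMatrix'_mulVec] at hxy
    exact hhi hxy)
  have hN : IsUnit (LinearMap.toMatrix' g) := mulVec_injective_iff_isUnit.1 (by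
    intro x y hxy
    simp only [LinearMap.toMatrix'_mulVec] at hxy
    exact hgi hxy)
  obtain ⟨M, hM⟩ := hM
  obtain ⟨N, hN⟩ := hN
  have hMN : ∀ x y, vecMulVec (h x) (g y) =
      (M : Matrix ι ι K) * vecMulVec x y * (N : Matrix ι ι K)ᵀ := by
    intro x y
    rw [← vecMulVec_mul_transpose, hM, hN, LinearMap.toMatrix'_mulVec, LinearMap.toMatrix'_mulVec]
  have hMi : ((M⁻¹ : (Matrix ι ι K)ˣ) : Matrix ι ι K) * (M : Matrix ι ι K) = 1 := M.inv_mul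
  have hMi' : (M : Matrix ι ι K) * ((M⁻¹ : (Matrix ι ι K)ˣ) : Matrix ι ι K) = 1 := M.mul_inv
  have hNi : (N : Matrix ι ι K)ᵀ * ((N⁻¹ : (Matrix ι ι K)ˣ) : Matrix ι ι K)ᵀ = 1 := by
    rw [← transpose_mul, N.inv_mul, transpose_one]
  have hNi' : ((N⁻¹ : (Matrix ι ι K)ˣ) : Matrix ι ι K)ᵀ * (N : Matrix ι ι K)ᵀ = 1 := by
    rw [← transpose_mul, N.mul_inv, transpose_one]
  obtain ⟨c, hc⟩ := exists_forall_eq_smul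
    (LinearMap.mulLeft K ((M⁻¹ : (Matrix ι ι K)ˣ) : Matrix ι ι K) ∘ₗ
      LinearMap.mulRight K ((N⁻¹ : (Matrix ι ι K)ˣ) : Matrix ι ι K)ᵀ ∘ₗ ψ) (by
    intro x y
    obtain ⟨c, hc⟩ := key x y
    refine ⟨c, ?_⟩
    simp only [LinearMap.comp_apply, LinearMap.mulLeft_apply, LinearMap.mulRight_apply]
    rw [hc, hMN, smul_mul_assoc, mul_smul_comm, mul_assoc (_ * _), hNi, mul_one, ← mul_assoc, hMi,
      one_mul])
  have hψ : ∀ X, ψ X = c • ((M : Matrix ι ι K) * X * (N : Matrix ι ι K)ᵀ) := by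
    intro X
    have h2 := hc X
    simp only [LinearMap.comp_apply, LinearMap.mulLeft_apply, LinearMap.mulRight_apply] at h2
    rw [← smul_mul_assoc, ← mul_smul_comm, ← h2, ← mul_assoc, hMi', one_mul, mul_assoc, hNi',
      mul_one]
  have hc0 : c ≠ 0 := by
    rintro rfl
    have h2 := hψ 1
    rw [zero_smul, map_eq_zero_iff ψ hinj] at h2
    exact one_ne_zero h2
  refine ⟨GeneralLinearGroup.scalar ι (Units.mk0 c hc0) * M, N, fun X => ?_⟩
  rw [hψ, GeneralLinearGroup.coe_mul, GeneralLinearGroup.coe_scalar, mul_assoc, mul_assoc,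
    mul_assoc, Units.val_mk0, scalar_apply, ← smul_eq_diagonal_mul]

/-- A linear injection of a full matrix algebra into itself that maps matrices of rank at most one
to matrices of rank at most one is, up to transposition, multiplication by invertible matrices on
both sides. -/
theorem exists_eq_mul_mul_transpose_or :
    ∃ M N : GL ι K, (∀ X, ψ X = (M : Matrix ι ι K) * X * (N : Matrix ι ι K)ᵀ) ∨
      ∀ X, ψ X = (M : Matrix ι ι K) * Xᵀ * (N : Matrix ι ι K)ᵀ := by
  rcases forall_commonColumn_or_forall_commonRow hinj hrank with h | h
  · obtain ⟨M, N, hMN⟩ := exists_eq_mul_mul_transpose hinj hrank h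
    exact ⟨M, N, Or.inl hMN⟩
  · obtain ⟨M, N, hMN⟩ := exists_eq_mul_mul_transpose
      (ψ := (transposeLinearEquiv ι ι K K).toLinearMap ∘ₗ ψ)
      (transpose_injective.comp hinj) (fun X hX => (rank_transpose (ψ X)).trans_le (hrank X hX))
      (fun x => by
        obtain ⟨v, hv⟩ := h x
        refine ⟨v, fun y => (hv y).imp fun g hg => ?_⟩
        rw [← transpose_vecMulVec, ← hg]
        rfl)
    refine ⟨N, M, Or.inr fun X => transpose_injective ((hMN X).trans ?_)⟩
    simp [mul_assoc]

end SingleBlock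

/-! ### The representation on tuples of matrices and its image -/

section MatrixTuples

variable {K : Type*} [Field K] {n ℓ : ℕ}

/-- The matrix `X` for `v = 0` and its transpose for `v = 1`. -/
def twist (v : Multiplicative (ZMod 2)) (X : Matrix (Fin n) (Fin n) K) :
    Matrix (Fin n) (Fin n) K :=
  if v = 1 then X else Xᵀ

omit [Field K] in
theorem twist_ofAdd (v : ZMod 2) (X : Matrix (Fin n) (Fin n) K) :
    twist (Multiplicative.ofAdd v) X = if v = 0 then X else Xᵀ := rfl

theorem twist_add (v : Multiplicative (ZMod 2)) (X Y : Matrix (Fin n) (Fin n) K) :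
    twist v (X + Y) = twist v X + twist v Y := by
  unfold twist; split_ifs <;> simp

theorem twist_smul (v : Multiplicative (ZMod 2)) (c : K) (X : Matrix (Fin n) (Fin n) K) :
    twist v (c • X) = c • twist v X := by
  unfold twist; split_ifs <;> simp

theorem rank_twist (v : Multiplicative (ZMod 2)) (X : Matrix (Fin n) (Fin n) K) :
    (twist v X).rank = X.rank := by
  unfold twist
  split_ifs
  · rfl
  · exact rank_transpose X

theorem mul_eq_one_iff_of_zmod_two :
    ∀ a b : Multiplicative (ZMod 2), a * b = 1 ↔ (a = 1 ↔ b = 1) := by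
  decide

/-- The representation of the group on tuples of matrices: the tuple `X` is mapped to the tuple
with entries `M_i X_{π⁻¹(i)} N_iᵀ`, where `X_{π⁻¹(i)}` is transposed if `v_i = 1`. -/
def rep : EquivGroup K n ℓ →* Module.End K (Fin ℓ → Matrix (Fin n) (Fin n) K) where
  toFun g :=
    { toFun := fun X i => (g.left.left.1 i : Matrix (Fin n) (Fin n) K) *
        twist (g.left.right i) (X (g.right.symm i)) *
        (g.left.left.2 i : Matrix (Fin n) (Fin n) K)ᵀ
      map_add' := fun X Y => by
        funext i
        simp only [Pi.add_apply, twist_add, mul_add, add_mul]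
      map_smul' := fun c X => by
        funext i
        simp only [Pi.smul_apply, twist_smul, mul_smul_comm, smul_mul_assoc, RingHom.id_apply] }
  map_one' := by
    refine LinearMap.ext fun X => funext fun i => ?_
    simp [twist]
    rfl
  map_mul' g h := by
    refine LinearMap.ext fun X => funext fun i => ?_
    have e1 : (g * h).left.left.1 i = g.left.left.1 i *
        (if g.left.right i = 1 then h.left.left.1 (g.right.symm i)
          else h.left.left.2 (g.right.symm i)) := rfl
    have e2 : (g * h).left.left.2 i = g.left.left.2 i *
        (if g.left.right i = 1 then h.left.left.2 (g.right.symm i)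
          else h.left.left.1 (g.right.symm i)) := rfl
    have e3 : (g * h).left.right i = g.left.right i * h.left.right (g.right.symm i) := rfl
    have e4 : (g * h).right.symm i = h.right.symm (g.right.symm i) := rfl
    simp only [LinearMap.coe_mk, AddHom.coe_mk, Module.End.mul_apply, e1, e2, e3, e4, twist,
      mul_eq_one_iff_of_zmod_two]
    by_cases hg : g.left.right i = 1 <;> by_cases hh : h.left.right (g.right.symm i) = 1 <;>
      simp [hg, hh, mul_assoc]

theorem rep_apply (g : EquivGroup K n ℓ) (X : Fin ℓ → Matrix (Fin n) (Fin n) K) (i : Fin ℓ) :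
    rep g X i = (g.left.left.1 i : Matrix (Fin n) (Fin n) K) *
        twist (g.left.right i) (X (g.right.symm i)) *
        (g.left.left.2 i : Matrix (Fin n) (Fin n) K)ᵀ :=
  rfl

/-- The sum of the ranks of the entries of a tuple of matrices. -/
def sumRank (X : Fin ℓ → Matrix (Fin n) (Fin n) K) : ℕ := ∑ i, (X i).rank

theorem rank_unit_mul_mul_transpose (M N : GL (Fin n) K) (X : Matrix (Fin n) (Fin n) K) :
    ((M : Matrix (Fin n) (Fin n) K) * X * (N : Matrix (Fin n) (Fin n) K)ᵀ).rank = X.rank := by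
  have hM : IsUnit (M : Matrix (Fin n) (Fin n) K).det := (isUnit_iff_isUnit_det _).1 M.isUnit
  have hN : IsUnit (N : Matrix (Fin n) (Fin n) K)ᵀ.det := by
    rw [det_transpose]
    exact (isUnit_iff_isUnit_det _).1 N.isUnit
  rw [rank_mul_eq_left_of_isUnit_det _ _ hN, rank_mul_eq_right_of_isUnit_det _ _ hM]

theorem sumRank_rep (g : EquivGroup K n ℓ) (X : Fin ℓ → Matrix (Fin n) (Fin n) K) :
    sumRank (rep g X) = sumRank X := by
  unfold sumRank
  simp only [rep_apply, rank_unit_mul_mul_transpose, rank_twist]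
  exact Equiv.sum_comp g.right.symm fun i => (X i).rank

theorem sumRank_single (i : Fin ℓ) (A : Matrix (Fin n) (Fin n) K) :
    sumRank (Pi.single i A) = A.rank := by
  unfold sumRank
  rw [Finset.sum_eq_single i]
  · rw [Pi.single_eq_same]
  · intro j _ hj
    rw [Pi.single_eq_of_ne hj, rank_zero]
  · exact fun h => absurd (Finset.mem_univ i) h

theorem rank_pos_of_ne_zero {A : Matrix (Fin n) (Fin n) K} (h : A ≠ 0) : 0 < A.rank := by
  rw [Nat.pos_iff_ne_zero]
  intro h0
  apply h
  rw [rank, Submodule.finrank_eq_zero, LinearMap.range_eq_bot] at h0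
  ext i j
  have := congrFun (LinearMap.congr_fun h0 (Pi.single j 1)) i
  simpa using this

/-- A tuple with two nonzero entries has sum-rank at least two. -/
theorem eq_of_sumRank_le_one {X : Fin ℓ → Matrix (Fin n) (Fin n) K} (h : sumRank X ≤ 1)
    {i j : Fin ℓ} (hi : X i ≠ 0) (hj : X j ≠ 0) : i = j := by
  by_contra hij
  have h1 := Finset.sum_le_sum_of_subset (f := fun k => (X k).rank)
    (Finset.subset_univ ({i, j} : Finset (Fin ℓ)))
  rw [Finset.sum_pair hij] at h1
  have h2 := rank_pos_of_ne_zero hi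
  have h3 := rank_pos_of_ne_zero hj
  unfold sumRank at h
  omega

variable (φ : (Fin ℓ → Matrix (Fin n) (Fin n) K) →ₗ[K] (Fin ℓ → Matrix (Fin n) (Fin n) K))

/-- The block of `φ` from the `i`-th to the `j`-th entry. -/
def block (j i : Fin ℓ) : Matrix (Fin n) (Fin n) K →ₗ[K] Matrix (Fin n) (Fin n) K :=
  LinearMap.proj j ∘ₗ φ ∘ₗ LinearMap.single K (fun _ => Matrix (Fin n) (Fin n) K) i

/-- An additive family of tuples of sum-rank at most one is supported at a single entry. -/
theorem index_unique {W : Type*} [AddCommGroup W] {f : W →+ (Fin ℓ → Matrix (Fin n) (Fin n) K)}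
    (hf : ∀ w, sumRank (f w) ≤ 1) {w z : W} {j k : Fin ℓ} (hj : f w j ≠ 0) (hk : f z k ≠ 0) :
    j = k := by
  by_contra hjk
  have h1 : f w k = 0 := by
    by_contra h
    exact hjk (eq_of_sumRank_le_one (hf w) hj h)
  have h2 : f z j = 0 := by
    by_contra h
    exact hjk (eq_of_sumRank_le_one (hf z) h hk)
  refine hjk (eq_of_sumRank_le_one (hf (w + z)) ?_ ?_)
  · rwa [map_add, Pi.add_apply, h2, add_zero]
  · rwa [map_add, Pi.add_apply, h1, zero_add]

variable {φ} (hinj : Function.Injective φ) (hφ : ∀ X, sumRank (φ X) = sumRank X)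
include hφ

theorem sumRank_map_vecMulVec_le (i : Fin ℓ) (x y : Fin n → K) :
    sumRank (φ (Pi.single i (vecMulVec x y))) ≤ 1 := by
  rw [hφ, sumRank_single]
  exact rank_vecMulVec_le x y

include hinj

/-- Each entry is mapped into a single entry. -/
theorem exists_forall_block_eq_zero (hn : 0 < n) (i : Fin ℓ) :
    ∃ j, ∀ k, k ≠ j → ∀ A, block φ k i A = 0 := by
  have : Nonempty (Fin n) := ⟨⟨0, hn⟩⟩
  have hne : ∀ x y : Fin n → K, x ≠ 0 → y ≠ 0 → ∃ j, block φ j i (vecMulVec x y) ≠ 0 := by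
    intro x y hx hy
    by_contra h
    push Not at h
    have h1 : φ (Pi.single i (vecMulVec x y)) = 0 := funext h
    rw [map_eq_zero_iff φ hinj, Pi.single_eq_zero_iff, vecMulVec_eq_zero] at h1
    exact h1.elim hx hy
  -- `x yᵀ` and `x' y'ᵀ` are both compared with `x y'ᵀ`.
  have hstep : ∀ x y x' y' : Fin n → K, ∀ j k, block φ j i (vecMulVec x y) ≠ 0 →
      block φ k i (vecMulVec x' y') ≠ 0 → x ≠ 0 → y' ≠ 0 → j = k := by
    intro x y x' y' j k hj hk hx hy'
    obtain ⟨l, hl⟩ := hne x y' hx hy'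
    have h1 : j = l := index_unique
      (f := (φ ∘ₗ LinearMap.single K _ i ∘ₗ vecMulVecBilin K K x).toAddMonoidHom)
      (fun w => sumRank_map_vecMulVec_le hφ i x w) hj hl
    have h2 : l = k := index_unique
      (f := (φ ∘ₗ LinearMap.single K _ i ∘ₗ (vecMulVecBilin K K).flip y').toAddMonoidHom)
      (fun w => sumRank_map_vecMulVec_le hφ i w y') hl hk
    exact h1.trans h2
  obtain ⟨j, hj⟩ := hne 1 1 one_ne_zero one_ne_zero
  refine ⟨j, fun k hk A => map_eq_zero_of_vecMulVec _ (fun x y => ?_) A⟩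
  by_contra h
  have hy : y ≠ 0 := by
    rintro rfl
    exact h (by rw [vecMulVec_zero, map_zero])
  exact hk (hstep 1 1 x y j k hj h one_ne_zero hy).symm

/-- The linear isometries for the sum-rank permute the entries, transpose some of them, and
multiply them by invertible matrices on both sides. -/
theorem exists_rep_eq (hn : 0 < n) : ∃ g : EquivGroup K n ℓ, rep g = φ := by
  have : Nonempty (Fin n) := ⟨⟨0, hn⟩⟩
  choose σ hσ using exists_forall_block_eq_zero hinj hφ hn
  have hsingle : ∀ i A, φ (Pi.single i A) = Pi.single (σ i) (block φ (σ i) i A) := by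
    intro i A
    funext k
    by_cases hk : k = σ i
    · subst hk
      rw [Pi.single_eq_same]
      rfl
    · rw [Pi.single_eq_of_ne hk]
      exact hσ i k hk A
  have hbinj : ∀ i, Function.Injective (block φ (σ i) i) := by
    intro i A B hAB
    apply Pi.single_injective (M := fun _ => Matrix (Fin n) (Fin n) K) i
    apply hinj
    rw [hsingle, hsingle, hAB]
  have hσinj : Function.Injective σ := by
    intro i j hij
    by_contra hne
    obtain ⟨B, hB⟩ := LinearMap.injective_iff_surjective.1 (hbinj j) (block φ (σ i) i 1)
    have h1 : φ (Pi.single i 1) = φ (Pi.single j B) := by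
      rw [hsingle, hsingle, hB, hij]
    have h2 := congrFun (hinj h1) i
    rw [Pi.single_eq_same, Pi.single_eq_of_ne hne] at h2
    exact one_ne_zero h2
  let π : Equiv.Perm (Fin ℓ) := Equiv.ofBijective σ (Finite.injective_iff_bijective.1 hσinj)
  have hblock : ∀ i, ∃ (M N : GL (Fin n) K) (v : Multiplicative (ZMod 2)), ∀ X,
      block φ (σ i) i X =
        (M : Matrix (Fin n) (Fin n) K) * twist v X * (N : Matrix (Fin n) (Fin n) K)ᵀ := by
    intro i
    have hr : ∀ X, X.rank ≤ 1 → (block φ (σ i) i X).rank ≤ 1 := by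
      intro X hX
      rw [← sumRank_single i, ← hφ, hsingle, sumRank_single] at hX
      exact hX
    obtain ⟨M, N, h | h⟩ := exists_eq_mul_mul_transpose_or (hbinj i) hr
    · exact ⟨M, N, 1, fun X => by rw [h, twist, if_pos rfl]⟩
    · exact ⟨M, N, Multiplicative.ofAdd 1, fun X => by rw [h, twist, if_neg (by decide)]⟩
  choose M N v hMN using hblock
  refine ⟨⟨⟨(M ∘ π.symm, N ∘ π.symm), v ∘ π.symm⟩, π⟩, LinearMap.ext fun X => funext fun j => ?_⟩
  obtain ⟨i, rfl⟩ := π.surjective j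
  have hX : φ X (π i) = block φ (σ i) i (X i) := by
    conv_lhs => rw [← Finset.univ_sum_single X, map_sum, Finset.sum_apply]
    rw [Finset.sum_eq_single i]
    · rfl
    · intro k _ hk
      exact hσ k _ (fun h => hk (hσinj h).symm) (X k)
    · exact fun h => absurd (Finset.mem_univ i) h
  rw [rep_apply, hX, hMN]
  simp only [Function.comp_apply, Equiv.symm_apply_apply]

end MatrixTuples

/-! ### The kernel of the representation -/

section Kernel

variable {K : Type*} [Field K] {n ℓ : ℕ}

omit [Field K] in
theorem twist_of_subsingleton [Subsingleton (Fin n)] (v : Multiplicative (ZMod 2))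
    (X : Matrix (Fin n) (Fin n) K) : twist v X = X := by
  unfold twist
  split_ifs
  · rfl
  · ext i j
    rw [transpose_apply, Subsingleton.elim i j]

/-- If `X ↦ M Xᵀ Nᵀ` is the identity, then matrix multiplication is commutative. -/
theorem mul_comm_of_forall_mul_transpose_mul_eq {M N : GL (Fin n) K}
    (h : ∀ X : Matrix (Fin n) (Fin n) K,
      (M : Matrix (Fin n) (Fin n) K) * Xᵀ * (N : Matrix (Fin n) (Fin n) K)ᵀ = X)
    (X Y : Matrix (Fin n) (Fin n) K) : X * Y = Y * X := by
  have h1 : (M : Matrix (Fin n) (Fin n) K) * (N : Matrix (Fin n) (Fin n) K)ᵀ = 1 := by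
    simpa using h 1
  have h2 : (N : Matrix (Fin n) (Fin n) K)ᵀ * (M : Matrix (Fin n) (Fin n) K) = 1 :=
    mul_eq_one_comm.1 h1
  calc X * Y = (M : Matrix (Fin n) (Fin n) K) * (X * Y)ᵀ * (N : Matrix (Fin n) (Fin n) K)ᵀ :=
        (h _).symm
    _ = M * Yᵀ * ((N : Matrix (Fin n) (Fin n) K)ᵀ * M) * Xᵀ *
          (N : Matrix (Fin n) (Fin n) K)ᵀ := by
        rw [h2, mul_one, transpose_mul]
        simp only [mul_assoc]
    _ = (M * Yᵀ * (N : Matrix (Fin n) (Fin n) K)ᵀ) *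
          (M * Xᵀ * (N : Matrix (Fin n) (Fin n) K)ᵀ) := by
        simp only [mul_assoc]
    _ = Y * X := by rw [h, h]

theorem exists_scalar_of_forall_mul_mul_transpose_eq {M N : GL (Fin n) K}
    (h : ∀ X : Matrix (Fin n) (Fin n) K,
      (M : Matrix (Fin n) (Fin n) K) * X * (N : Matrix (Fin n) (Fin n) K)ᵀ = X) :
    ∃ c : Kˣ, M = GeneralLinearGroup.scalar (Fin n) c ∧
      N = GeneralLinearGroup.scalar (Fin n) c⁻¹ := by
  have h1 : (M : Matrix (Fin n) (Fin n) K) * (N : Matrix (Fin n) (Fin n) K)ᵀ = 1 := by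
    simpa using h 1
  have h2 : (N : Matrix (Fin n) (Fin n) K)ᵀ * (M : Matrix (Fin n) (Fin n) K) = 1 :=
    mul_eq_one_comm.1 h1
  have hc : M ∈ Subgroup.center (GL (Fin n) K) := by
    rw [Subgroup.mem_center_iff]
    intro g
    apply Units.ext
    rw [Units.val_mul, Units.val_mul]
    calc (g : Matrix (Fin n) (Fin n) K) * M
        = M * g * (N : Matrix (Fin n) (Fin n) K)ᵀ * M := by rw [h]
      _ = M * g := by rw [mul_assoc, h2, mul_one]
  rw [GeneralLinearGroup.center_eq_range_scalar] at hc
  obtain ⟨c, rfl⟩ := hc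
  refine ⟨c, rfl, ?_⟩
  rw [map_inv, eq_inv_iff_mul_eq_one]
  apply Units.ext
  have h3 := congrArg transpose h1
  rw [transpose_mul, transpose_transpose, transpose_one] at h3
  rw [Units.val_mul, Units.val_one, ← h3]
  congr 1
  simp

theorem rep_eq_one_iff (hn : 0 < n) (g : EquivGroup K n ℓ) :
    rep g = 1 ↔ g ∈ scalarSubgroup K n ℓ := by
  have : Nonempty (Fin n) := ⟨⟨0, hn⟩⟩
  constructor
  · intro h
    have happ : ∀ (X : Fin ℓ → Matrix (Fin n) (Fin n) K) i,
        (g.left.left.1 i : Matrix (Fin n) (Fin n) K) *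
        twist (g.left.right i) (X (g.right.symm i)) *
        (g.left.left.2 i : Matrix (Fin n) (Fin n) K)ᵀ = X i := fun X i =>
      congrFun (LinearMap.congr_fun h X) i
    have hπ : g.right = 1 := by
      rw [← inv_eq_one]
      refine Equiv.ext fun i => ?_
      by_contra hne
      have hne' : g.right.symm i ≠ i := hne
      have h1 := happ (Pi.single i 1) i
      rw [Pi.single_eq_same, Pi.single_eq_of_ne hne'] at h1
      apply one_ne_zero (α := Matrix (Fin n) (Fin n) K)
      rw [← h1]
      simp [twist]
    have hloc : ∀ i A, (g.left.left.1 i : Matrix (Fin n) (Fin n) K) *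
        twist (g.left.right i) A * (g.left.left.2 i : Matrix (Fin n) (Fin n) K)ᵀ = A := by
      intro i A
      have h1 := happ (fun _ => A) i
      exact h1
    have hv : n ≠ 1 → g.left.right = 1 := by
      intro hn1
      funext i
      by_contra hvi
      have hv : ¬g.left.right i = 1 := hvi
      have h1 : (1 : ℕ) < n := by omega
      have hcomm := mul_comm_of_forall_mul_transpose_mul_eq (M := g.left.left.1 i)
        (N := g.left.left.2 i) (fun X => by
          have h2 := hloc i X
          unfold twist at h2
          rwa [if_neg hv] at h2)
        (single ⟨0, hn⟩ ⟨0, hn⟩ (1 : K)) (single ⟨0, hn⟩ ⟨1, h1⟩ (1 : K))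
      rw [single_mul_single_same, single_mul_single_of_ne _ _ _ _ (by simp)] at hcomm
      have h2 := congrFun (congrFun hcomm ⟨0, hn⟩) ⟨1, h1⟩
      simp at h2
    refine ⟨hπ, hv, ?_⟩
    have hscal : ∀ i, ∃ c : Kˣ, g.left.left.1 i = GeneralLinearGroup.scalar (Fin n) c ∧
        g.left.left.2 i = GeneralLinearGroup.scalar (Fin n) c⁻¹ := by
      intro i
      apply exists_scalar_of_forall_mul_mul_transpose_eq
      intro X
      by_cases hn1 : n = 1
      · have : Subsingleton (Fin n) := by
          subst hn1
          infer_instance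
        simpa only [twist_of_subsingleton] using hloc i X
      · have h2 := hloc i X
        rw [hv hn1] at h2
        simpa only [twist, Pi.one_apply, if_true] using h2
    choose c hc using hscal
    exact ⟨c, hc⟩
  · rintro ⟨hπ, hv, c, hc⟩
    refine LinearMap.ext fun X => funext fun i => ?_
    have ht : twist (g.left.right i) (X (g.right.symm i)) = X i := by
      have h1 : g.right.symm i = i := by rw [hπ]; rfl
      rw [h1]
      by_cases hn1 : n = 1
      · have : Subsingleton (Fin n) := by
          subst hn1
          infer_instance
        exact twist_of_subsingleton _ _
      · rw [hv hn1]
        rfl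
    rw [rep_apply, ht, (hc i).1, (hc i).2, Module.End.one_apply, GeneralLinearGroup.coe_scalar,
      GeneralLinearGroup.coe_scalar, scalar_apply, scalar_apply, diagonal_transpose]
    ext a b
    rw [mul_diagonal, diagonal_mul, mul_right_comm, Units.mul_inv, one_mul]

end Kernel

/-! ### The adjoint as a transpose -/

section Adjoint

variable {K L : Type*} [Field K] [Field L] [Algebra K L]

theorem adjoint_single (g : L ≃ₐ[K] L) (a : L) :
    adjoint (SkewMonoidAlgebra.single g a : SkewGroupAlg K L) =
      SkewMonoidAlgebra.single g⁻¹ (g⁻¹ a) :=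
  SkewMonoidAlgebra.sum_single_index (by rw [map_zero, SkewMonoidAlgebra.single_zero])

theorem adjoint_add (f g : SkewGroupAlg K L) : adjoint (f + g) = adjoint f + adjoint g :=
  SkewMonoidAlgebra.sum_add_index' (fun h => by rw [map_zero, SkewMonoidAlgebra.single_zero])
    fun h a b => by rw [map_add, SkewMonoidAlgebra.single_add]

/-- The adjoint in the skew group algebra is the adjoint for the trace form. -/
theorem trace_toEnd_mul (f : SkewGroupAlg K L) (x y : L) :
    Algebra.trace K L (toEnd f x * y) = Algebra.trace K L (x * toEnd (adjoint f) y) := by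
  induction f using SkewMonoidAlgebra.induction_on' with
  | single g a =>
    rw [adjoint_single, toEnd_single, toEnd_single,
      ← Algebra.trace_eq_of_algEquiv g⁻¹ (a * g x * y)]
    have h : g⁻¹ (g x) = x := g.symm_apply_apply x
    rw [map_mul g⁻¹, map_mul g⁻¹, h, mul_left_comm, mul_assoc]
  | add f g hf hg =>
    rw [adjoint_add, map_add, map_add, LinearMap.add_apply, LinearMap.add_apply, add_mul, mul_add,
      map_add, map_add, hf, hg]

variable [FiniteDimensional K L]

/-- The skew group algebra acting on `L`, in matrices with respect to a fixed basis of `L`. -/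
def toMat : SkewGroupAlg K L →+*
    Matrix (Fin (Module.finrank K L)) (Fin (Module.finrank K L)) K :=
  (LinearMap.toMatrixAlgEquiv (Module.finBasis K L)).toAlgHom.toRingHom.comp toEnd

theorem toMat_apply (f : SkewGroupAlg K L) :
    toMat f = LinearMap.toMatrix (Module.finBasis K L) (Module.finBasis K L) (toEnd f) := rfl

theorem toMat_injective : Function.Injective (toMat : SkewGroupAlg K L →+* _) :=
  (LinearMap.toMatrixAlgEquiv (Module.finBasis K L)).injective.comp toEnd_injective

theorem rank_toMatrix (f : Module.End K L) :
    (LinearMap.toMatrix (Module.finBasis K L) (Module.finBasis K L) f).rank =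
      Module.finrank K (LinearMap.range f) := by
  rw [rank_eq_finrank_range_toLin _ (Module.finBasis K L) (Module.finBasis K L),
    toLin_toMatrix]

/-- In matrices, the adjoint is the transpose up to conjugation by the Gram matrix of the trace
form. -/
theorem exists_toMat_adjoint (K L : Type*) [Field K] [Field L] [Algebra K L]
    [FiniteDimensional K L] [IsGalois K L] :
    ∃ T : GL (Fin (Module.finrank K L)) K, ∀ f : SkewGroupAlg K L,
      toMat (adjoint f) = (T⁻¹).val * (toMat f)ᵀ * T.val := by
  set b := Module.finBasis K L with hb
  have hdet : (Algebra.traceMatrix K b).det ≠ 0 := by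
    rw [Algebra.traceMatrix_of_basis]
    exact (LinearMap.BilinForm.nondegenerate_iff_det_ne_zero b).1 (traceForm_nondegenerate K L)
  obtain ⟨T, hT⟩ := (isUnit_iff_isUnit_det _).2 (isUnit_iff_ne_zero.2 hdet)
  have hcol : ∀ (f : SkewGroupAlg K L) j, toEnd f (b j) = ∑ k, toMat f k j • b k := by
    intro f j
    refine (b.sum_repr (toEnd f (b j))).symm.trans (Finset.sum_congr rfl fun k _ => ?_)
    rw [toMat_apply, LinearMap.toMatrix_apply]
  refine ⟨T, fun f => ?_⟩
  have key : T.val * toMat (adjoint f) = (toMat f)ᵀ * T.val := by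
    ext i j
    have h := trace_toEnd_mul f (b i) (b j)
    rw [hcol, hcol, Finset.sum_mul, Finset.mul_sum, map_sum, map_sum] at h
    simp only [smul_mul_assoc, mul_smul_comm, map_smul, smul_eq_mul] at h
    rw [hT, mul_apply, mul_apply]
    simp only [transpose_apply, Algebra.traceMatrix_apply, Algebra.traceForm_apply]
    rw [h]
    exact Finset.sum_congr rfl fun k _ => mul_comm _ _
  rw [mul_assoc, ← key, ← mul_assoc, T.inv_mul, one_mul]

end Adjoint

/-! ### The isomorphism with tuples of matrices -/

section Quotient

variable {K L : Type*} [Field K] [Field L] [Algebra K L] [FiniteDimensional K L] [IsGalois K L]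
  {θ : L ≃ₐ[K] L} (hθ : ∀ σ : L ≃ₐ[K] L, σ ∈ Subgroup.zpowers θ) {ℓ : ℕ} (α : Fin ℓ → L)
  (hα : ∀ i, α i ≠ 0) (lam : Fin ℓ → K) (hlam : ∀ i, lam i = Algebra.norm K (α i))
  (hinj : Function.Injective lam)

/-- The ring homomorphism `F ↦ Φ̄_α(F)`, followed by passage to matrices. -/
def matHom : SkewQuot θ lam →+*
    (Fin ℓ → Matrix (Fin (Module.finrank K L)) (Fin (Module.finrank K L)) K) :=
  RingHom.pi fun i => toMat.comp
    ((Pi.evalRingHom _ i).comp (PhiBar θ hθ lam α fun i => ⟨i, hlam i⟩))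

theorem matHom_apply (F : SkewQuot θ lam) (i : Fin ℓ) :
    matHom hθ α lam hlam F i = toMat (PhiBar θ hθ lam α (fun i => ⟨i, hlam i⟩) F i) := rfl

theorem matHom_mk (F : SkewPoly θ) (i : Fin ℓ) :
    matHom hθ α lam hlam (Ideal.Quotient.mk (hIdeal θ lam) F) i =
      LinearMap.toMatrix (Module.finBasis K L) (Module.finBasis K L) (eval θ (α i) F) := rfl

/-- `matHom` is `K`-linear; the scalar action on the quotient is multiplication by constants. -/
theorem matHom_smul (k : K) (F : SkewQuot θ lam) :
    matHom hθ α lam hlam (k • F) = k • matHom hθ α lam hlam F := by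
  obtain ⟨F, rfl⟩ := Ideal.Quotient.mk_surjective F
  have h : k • (Ideal.Quotient.mk (hIdeal θ lam) F) =
      Ideal.Quotient.mk (hIdeal θ lam) (SkewPoly.C θ (algebraMap K L k) * F) := by
    rw [← SkewPoly.algebraMap_eq, ← Algebra.smul_def]
    rfl
  funext i
  rw [h, Pi.smul_apply, matHom_mk, matHom_mk, ← map_smul]
  congr 1
  ext x
  rw [eval_C_mul, LinearMap.smul_apply, Algebra.smul_def]

include hα hinj

theorem matHom_bijective : Function.Bijective (matHom hθ α lam hlam) := by
  constructor
  · rw [injective_iff_map_eq_zero]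
    intro F hF
    obtain ⟨F, rfl⟩ := Ideal.Quotient.mk_surjective F
    rw [Ideal.Quotient.eq_zero_iff_mem]
    refine mem_hIdeal_of_eval_eq_zero hθ α hα lam hlam hinj F fun i => ?_
    have h := congrFun hF i
    rwa [matHom_mk, Pi.zero_apply, LinearEquiv.map_eq_zero_iff] at h
  · intro Y
    obtain ⟨F, hF⟩ := exists_eval_eq hθ α hα lam hlam hinj
      fun i => Matrix.toLin (Module.finBasis K L) (Module.finBasis K L) (Y i)
    refine ⟨Ideal.Quotient.mk _ F, funext fun i => ?_⟩
    rw [matHom_mk, hF, LinearMap.toMatrix_toLin]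

theorem PhiBar_bijective : Function.Bijective (PhiBar θ hθ lam α fun i => ⟨i, hlam i⟩) := by
  obtain ⟨h1, h2⟩ := matHom_bijective hθ α hα lam hlam hinj
  constructor
  · intro F G h
    apply h1
    funext i
    rw [matHom_apply, matHom_apply, h]
  · intro f
    obtain ⟨F, hF⟩ := h2 fun i => toMat (f i)
    exact ⟨F, funext fun i => toMat_injective (congrFun hF i)⟩

/-- The `K`-linear isomorphism from `L[X;θ]/(H_Λ)` onto the tuples of matrices. -/
def matEquiv : SkewQuot θ lam ≃ₗ[K]
    (Fin ℓ → Matrix (Fin (Module.finrank K L)) (Fin (Module.finrank K L)) K) :=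
  LinearEquiv.ofBijective
    { toFun := matHom hθ α lam hlam
      map_add' := map_add _
      map_smul' := matHom_smul hθ α lam hlam }
    (matHom_bijective hθ α hα lam hlam hinj)

theorem matEquiv_apply (F : SkewQuot θ lam) :
    matEquiv hθ α hα lam hlam hinj F = matHom hθ α lam hlam F := rfl

theorem weight_eq_sumRank (F : SkewQuot θ lam) :
    weight θ lam F = sumRank (matEquiv hθ α hα lam hlam hinj F) := by
  obtain ⟨F, rfl⟩ := Ideal.Quotient.mk_surjective F
  rw [weight_mk hθ α hα lam hlam hinj, matEquiv_apply, sumRank]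
  simp only [matHom_mk, rank_toMatrix]

end Quotient

/-! ### Tuples of full rank -/

section FullRank

variable {K : Type*} [Field K] {n ℓ : ℕ}

theorem isUnit_of_rank_eq {A : Matrix (Fin n) (Fin n) K} (h : A.rank = n) : IsUnit A := by
  rw [← mulVec_surjective_iff_isUnit]
  have h1 : LinearMap.range A.mulVecLin = ⊤ :=
    Submodule.eq_top_of_finrank_eq (by rw [Module.finrank_fin_fun]; exact h)
  exact LinearMap.range_eq_top.1 h1

theorem sumRank_eq_iff {X : Fin ℓ → Matrix (Fin n) (Fin n) K} :
    sumRank X = ℓ * n ↔ ∀ i, IsUnit (X i) := by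
  have hle : ∀ i ∈ Finset.univ, (X i).rank ≤ n := fun i _ => by
    simpa using (X i).rank_le_card_width
  have h := Finset.sum_eq_sum_iff_of_le hle
  rw [Finset.sum_const, Finset.card_univ, Fintype.card_fin, smul_eq_mul] at h
  rw [sumRank, h]
  refine ⟨fun h i => isUnit_of_rank_eq (h i (Finset.mem_univ i)), fun h i _ => ?_⟩
  rw [rank_of_isUnit _ (h i), Fintype.card_fin]

/-- The representation on tuples of matrices, with values in the linear automorphisms. -/
def repEquiv : EquivGroup K n ℓ →*
    ((Fin ℓ → Matrix (Fin n) (Fin n) K) ≃ₗ[K] (Fin ℓ → Matrix (Fin n) (Fin n) K)) :=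
  (LinearMap.GeneralLinearGroup.generalLinearEquiv K _).toMonoidHom.comp rep.toHomUnits

theorem repEquiv_apply (g : EquivGroup K n ℓ) (X : Fin ℓ → Matrix (Fin n) (Fin n) K) :
    repEquiv g X = rep g X := rfl

end FullRank

/-! ### The group of isometries -/

section Isometries

variable {K L : Type*} [Field K] [Field L] [Algebra K L] [FiniteDimensional K L] [IsGalois K L]
  {θ : L ≃ₐ[K] L} (hθ : ∀ σ : L ≃ₐ[K] L, σ ∈ Subgroup.zpowers θ) {ℓ : ℕ} (α : Fin ℓ → L)
  (hα : ∀ i, α i ≠ 0) (lam : Fin ℓ → K) (hlam : ∀ i, lam i = Algebra.norm K (α i))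
  (hinj : Function.Injective lam)

/-- The action of the group on `L[X;θ]/(H_Λ)` by isometries, obtained by transport of its
representation on tuples of matrices. -/
def isometryHom : EquivGroup K (Module.finrank K L) ℓ →* isometryGroup θ lam where
  toFun g := ⟨((matEquiv hθ α hα lam hlam hinj).trans (repEquiv g)).trans
      (matEquiv hθ α hα lam hlam hinj).symm, fun F G => by
    unfold sumRankDist
    rw [← map_sub, weight_eq_sumRank hθ α hα lam hlam hinj,
      weight_eq_sumRank hθ α hα lam hlam hinj, LinearEquiv.trans_apply, LinearEquiv.trans_apply,
      LinearEquiv.apply_symm_apply, repEquiv_apply, sumRank_rep]⟩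
  map_one' := Subtype.ext (LinearEquiv.ext fun F => by simp)
  map_mul' g h := Subtype.ext (LinearEquiv.ext fun F => by simp)

theorem matEquiv_isometryHom (g : EquivGroup K (Module.finrank K L) ℓ) (F : SkewQuot θ lam) :
    matEquiv hθ α hα lam hlam hinj ((isometryHom hθ α hα lam hlam hinj g).1 F) =
      rep g (matEquiv hθ α hα lam hlam hinj F) :=
  LinearEquiv.apply_symm_apply _ _

theorem ker_isometryHom : (isometryHom hθ α hα lam hlam hinj).ker =
    scalarSubgroup K (Module.finrank K L) ℓ := by
  ext g
  rw [MonoidHom.mem_ker, ← rep_eq_one_iff Module.finrank_pos]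
  constructor
  · intro h
    refine LinearMap.ext fun X => ?_
    have h1 := matEquiv_isometryHom hθ α hα lam hlam hinj g
      ((matEquiv hθ α hα lam hlam hinj).symm X)
    rw [h, LinearEquiv.apply_symm_apply] at h1
    rw [← h1]
    exact LinearEquiv.apply_symm_apply _ _
  · intro h
    refine Subtype.ext (LinearEquiv.ext fun F => (matEquiv hθ α hα lam hlam hinj).injective ?_)
    rw [matEquiv_isometryHom, h]
    rfl

/-- Every isometry comes from the group: transported to tuples of matrices it preserves the
sum of the ranks. -/
theorem isometryHom_surjective : Function.Surjective (isometryHom hθ α hα lam hlam hinj) := by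
  intro φ
  set Ψ := matEquiv hθ α hα lam hlam hinj with hΨ
  obtain ⟨g, hg⟩ := exists_rep_eq (φ := ((Ψ.symm.trans φ.1).trans Ψ).toLinearMap)
    ((Ψ.symm.trans φ.1).trans Ψ).injective (fun X => by
      have h := φ.2 (Ψ.symm X) 0
      unfold sumRankDist at h
      rw [map_zero, sub_zero, sub_zero, weight_eq_sumRank hθ α hα lam hlam hinj,
        weight_eq_sumRank hθ α hα lam hlam hinj, ← hΨ, LinearEquiv.apply_symm_apply] at h
      exact h) (Module.finrank_pos (R := K) (M := L))
  refine ⟨g, Subtype.ext (LinearEquiv.ext fun F => Ψ.injective ?_)⟩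
  rw [matEquiv_isometryHom, hg]
  change Ψ (φ.1 (Ψ.symm (Ψ F))) = _
  rw [LinearEquiv.symm_apply_apply]

/-- The group modulo its scalar subgroup is isomorphic to the group of isometries. -/
def isometryEquiv : EquivGroup K (Module.finrank K L) ℓ ⧸ scalarSubgroup K (Module.finrank K L) ℓ
    ≃* isometryGroup θ lam :=
  (QuotientGroup.quotientMulEquivOfEq (ker_isometryHom hθ α hα lam hlam hinj).symm).trans
    (QuotientGroup.quotientKerEquivOfSurjective _ (isometryHom_surjective hθ α hα lam hlam hinj))

theorem isometryEquiv_mk (g : EquivGroup K (Module.finrank K L) ℓ) :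
    isometryEquiv hθ α hα lam hlam hinj (QuotientGroup.mk g) =
      isometryHom hθ α hα lam hlam hinj g := rfl

theorem PhiBar_permute (π : Equiv.Perm (Fin ℓ)) (F : SkewQuot θ lam) (i : Fin ℓ) :
    PhiBar θ hθ lam (fun i => α (π.symm i)) (fun i => ⟨π.symm i, hlam (π.symm i)⟩) F i =
      PhiBar θ hθ lam α (fun i => ⟨i, hlam i⟩) F (π.symm i) := by
  obtain ⟨F, rfl⟩ := Ideal.Quotient.mk_surjective F
  rfl

/-- The matrices of the `v`-adjoint of `F` are the permuted matrices of `F`, some of them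
transposed and conjugated by the Gram matrix of the trace form. -/
theorem matHom_vAdjoint {T : GL (Fin (Module.finrank K L)) K}
    (hT : ∀ f : SkewGroupAlg K L, toMat (adjoint f) = (T⁻¹).val * (toMat f)ᵀ * T.val)
    (hα : ∀ i, α i ≠ 0) (hinj : Function.Injective lam) (π : Equiv.Perm (Fin ℓ))
    (v : Fin ℓ → ZMod 2) (F : SkewQuot θ lam) (i : Fin ℓ) :
    matHom hθ α lam hlam (vAdjoint θ hθ lam (fun i => α (π.symm i)) α
        (fun i => ⟨π.symm i, hlam (π.symm i)⟩) (fun i => ⟨i, hlam i⟩) v F) i =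
      (if v i = 0 then 1 else T⁻¹).val *
        twist (Multiplicative.ofAdd (v i)) (matHom hθ α lam hlam F (π.symm i)) *
        (if v i = 0 then 1 else T).val := by
  have h : PhiBar θ hθ lam α (fun i => ⟨i, hlam i⟩) (vAdjoint θ hθ lam (fun i => α (π.symm i)) α
      (fun i => ⟨π.symm i, hlam (π.symm i)⟩) (fun i => ⟨i, hlam i⟩) v F) = partialAdjoint v
        (PhiBar θ hθ lam (fun i => α (π.symm i)) (fun i => ⟨π.symm i, hlam (π.symm i)⟩) F) :=
    Function.rightInverse_invFun (PhiBar_bijective hθ α hα lam hlam hinj).2 _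
  rw [matHom_apply, h, partialAdjoint, PhiBar_permute hθ α lam hlam, twist_ofAdd]
  by_cases hv : v i = 0
  · rw [if_pos hv, if_pos hv, if_pos hv, if_pos hv, Units.val_one, one_mul, mul_one]
    rfl
  · rw [if_neg hv, if_neg hv, if_neg hv, if_neg hv, hT]
    rfl

end Isometries

end SumRank

theorem mainTheorem11 {K L : Type*} [Field K] [Field L] [Algebra K L]
    [FiniteDimensional K L] [IsGalois K L]
    (θ : L ≃ₐ[K] L) (hθ : ∀ σ : L ≃ₐ[K] L, σ ∈ Subgroup.zpowers θ)
    {ℓ : ℕ} (α : Fin ℓ → L) (hα : ∀ i, α i ≠ 0)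
    (lam : Fin ℓ → K) (hlam : ∀ i, lam i = Algebra.norm K (α i))
    (hinj : Function.Injective lam) :
    Function.Bijective (SumRank.PhiBar θ hθ lam α fun i => ⟨i, hlam i⟩) ∧
    ∃ e : (SumRank.EquivGroup K (Module.finrank K L) ℓ ⧸
          SumRank.scalarSubgroup K (Module.finrank K L) ℓ) ≃* SumRank.isometryGroup θ lam,
      (∀ (π : Equiv.Perm (Fin ℓ)) (M N : Fin ℓ → GL (Fin (Module.finrank K L)) K)
          (v : Fin ℓ → ZMod 2),
        ∃ A B : SumRank.SkewQuot θ lam,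
          SumRank.weight θ lam A = ℓ * Module.finrank K L ∧
          SumRank.weight θ lam B = ℓ * Module.finrank K L ∧
          ∀ F : SumRank.SkewQuot θ lam,
            (e (QuotientGroup.mk (SumRank.EquivGroup.mk π M N v))).1 F =
              A * SumRank.vAdjoint θ hθ lam (fun i => α (π.symm i)) α
                (fun i => ⟨π.symm i, hlam (π.symm i)⟩) (fun i => ⟨i, hlam i⟩) v F * B) ∧
      (∀ (π : Equiv.Perm (Fin ℓ)) (v : Fin ℓ → ZMod 2) (A B : SumRank.SkewQuot θ lam),
        SumRank.weight θ lam A = ℓ * Module.finrank K L →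
        SumRank.weight θ lam B = ℓ * Module.finrank K L →
        ∃ M N : Fin ℓ → GL (Fin (Module.finrank K L)) K,
          ∀ F : SumRank.SkewQuot θ lam,
            (e (QuotientGroup.mk (SumRank.EquivGroup.mk π M N v))).1 F =
              A * SumRank.vAdjoint θ hθ lam (fun i => α (π.symm i)) α
                (fun i => ⟨π.symm i, hlam (π.symm i)⟩) (fun i => ⟨i, hlam i⟩) v F * B) := by
  obtain ⟨T, hT⟩ := SumRank.exists_toMat_adjoint K L
  have hw : ∀ A : SumRank.SkewQuot θ lam,
      SumRank.weight θ lam A = ℓ * Module.finrank K L ↔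
        ∀ i, IsUnit (SumRank.matHom hθ α lam hlam A i) := fun A => by
    rw [SumRank.weight_eq_sumRank hθ α hα lam hlam hinj, SumRank.sumRank_eq_iff]
    rfl
  have hsurj := (SumRank.matHom_bijective hθ α hα lam hlam hinj).2
  -- `M Xᵀ Nᵀ = (M T) (T⁻¹ Xᵀ T) (T⁻¹ Nᵀ)`, so it suffices to compare the outer factors.
  have key : ∀ (π : Equiv.Perm (Fin ℓ)) (M N : Fin ℓ → GL (Fin (Module.finrank K L)) K)
      (v : Fin ℓ → ZMod 2) (A B : SumRank.SkewQuot θ lam),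
      (∀ i, SumRank.matHom hθ α lam hlam A i * (if v i = 0 then 1 else T⁻¹).val = (M i).val) →
      (∀ i, (if v i = 0 then 1 else T).val * SumRank.matHom hθ α lam hlam B i =
        (N i).val.transpose) →
      ∀ F : SumRank.SkewQuot θ lam,
        (SumRank.isometryEquiv hθ α hα lam hlam hinj
          (QuotientGroup.mk (SumRank.EquivGroup.mk π M N v))).1 F =
          A * SumRank.vAdjoint θ hθ lam (fun i => α (π.symm i)) α
            (fun i => ⟨π.symm i, hlam (π.symm i)⟩) (fun i => ⟨i, hlam i⟩) v F * B := by
    intro π M N v A B hA hB F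
    apply (SumRank.matEquiv hθ α hα lam hlam hinj).injective
    rw [SumRank.isometryEquiv_mk, SumRank.matEquiv_isometryHom, SumRank.matEquiv_apply,
      SumRank.matEquiv_apply, map_mul, map_mul]
    funext i
    rw [SumRank.rep_apply, Pi.mul_apply, Pi.mul_apply,
      SumRank.matHom_vAdjoint hθ α lam hlam hT hα hinj]
    change (M i).val * SumRank.twist (Multiplicative.ofAdd (v i))
      (SumRank.matHom hθ α lam hlam F (π.symm i)) * (N i).val.transpose = _
    rw [← hA, ← hB]
    simp only [mul_assoc]
  refine ⟨SumRank.PhiBar_bijective hθ α hα lam hlam hinj,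
    SumRank.isometryEquiv hθ α hα lam hlam hinj, ?_, ?_⟩
  · intro π M N v
    obtain ⟨A, hA⟩ := hsurj fun i => (M i * if v i = 0 then 1 else T).val
    obtain ⟨B, hB⟩ := hsurj fun i =>
      (if v i = 0 then 1 else T⁻¹).val * (N i).val.transpose
    refine ⟨A, B, (hw A).2 fun i => ?_, (hw B).2 fun i => ?_, key π M N v A B
      (fun i => ?_) fun i => ?_⟩
    · rw [hA]
      exact Units.isUnit _
    · rw [hB]
      exact (Units.isUnit _).mul ((Matrix.isUnit_transpose _).2 (N i).isUnit)
    · rw [hA, ← Units.val_mul]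
      congr 1
      split_ifs <;> simp
    · rw [hB, ← mul_assoc, ← Units.val_mul]
      split_ifs <;> simp
  · intro π v A B hA hB
    rw [hw] at hA hB
    choose M hM using hA
    choose N hN using fun i => (Matrix.isUnit_transpose _).2 (hB i)
    refine ⟨fun i => M i * if v i = 0 then 1 else T⁻¹, fun i => N i *
      (if v i = 0 then 1 else
        ((Matrix.isUnit_transpose _).2 T.isUnit).unit), key π _ _ v A B (fun i => ?_) fun i => ?_⟩
    · rw [← hM]
      rfl
    · rw [Units.val_mul, Matrix.transpose_mul, hN, Matrix.transpose_transpose]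
      split_ifs <;> simp
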